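/- Let $d\ge 1$ and let $T$ be a linear operator on the Schwartz space of complex-valued functions on $\mathbb{R}^d$. Suppose that $T$ is a Calderón–Zygmund operator, that is: $T$ is bounded on $L^2(\mathbb{R}^d)$ (there is a constant $C$ with $\|Tf\|_{L^2}\le C\|f\|_{L^2}$ for all Schwartz functions $f$), and for every Schwartz function $f$ and almost every $x\in\mathbb{R}^d$ the following limit exists and satisfies $$(Tf)(x)=\mathrm{p.v.}\int_{\mathbb{R}^d}K(x,y)f(y)\,dy:=\lim_{\varepsilon\to0^+}\int_{|x-y|>\varepsilon}K(x,y)f(y)\,dy,$$ where the complex-valued kernel $K$ is of class $C^1$ on $\{(x,y)\in\mathbb{R}^d\times\mathbb{R}^d: x\ne y\}$ and there is a constant $C$ such that, for all $x\neq y$, $$|K(x,y)|\le C|x-y|^{-d},\qquad |\partial_xK(x,y)|+|\partial_yK(x,y)|\le C|x-y|^{-(d+1)}.$$ Then for every $1<p<\infty$ the discrete analogue $$(T_{\mathrm{dis}}f)(n)=\sum_{m\in\mathbb{Z}^d\setminus\{n\}}K(n,m)f(m),\qquad f\in\ell^p(\mathbb{Z}^d),\ n\in\mathbb{Z}^d,$$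 is given by absolutely convergent series and defines a bounded linear operator on $\ell^p(\mathbb{Z}^d)$. -/

import Mathlib

open MeasureTheory Filter Topology
open scoped SchwartzMap NNReal ENNReal

/-- `T`, a linear operator on the Schwartz space of `ℝ^d` with values in (measurable) functions,
is a Calderón–Zygmund operator with kernel `K`. The values of `K` on the diagonal are irrelevant. -/
structure IsCalderonZygmund {d : ℕ}
    (T : 𝓢(EuclideanSpace ℝ (Fin d), ℂ) →ₗ[ℂ] (EuclideanSpace ℝ (Fin d) → ℂ))
    (K : EuclideanSpace ℝ (Fin d) → EuclideanSpace ℝ (Fin d) → ℂ) : Prop where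
  /-- `T` is bounded on `L²(ℝ^d)`. -/
  bounded_L2 : ∃ C : ℝ≥0, ∀ f : 𝓢(EuclideanSpace ℝ (Fin d), ℂ),
    MemLp (T f) 2 volume ∧ eLpNorm (T f) 2 volume ≤ C * eLpNorm f 2 volume
  /-- The principal value integral exists at almost every point and represents `T f`. -/
  principal_value : ∀ f : 𝓢(EuclideanSpace ℝ (Fin d), ℂ),
    ∀ᵐ x : EuclideanSpace ℝ (Fin d),
      Tendsto (fun ε : ℝ => ∫ y in {y | ε < ‖x - y‖}, K x y * f y) (𝓝[>] 0) (𝓝 (T f x))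
  /-- The kernel is continuously differentiable off the diagonal. -/
  contDiffOn : ContDiffOn ℝ 1 (fun z : EuclideanSpace ℝ (Fin d) × EuclideanSpace ℝ (Fin d) =>
    K z.1 z.2) {z | z.1 ≠ z.2}
  /-- Size condition. -/
  size : ∃ C : ℝ, ∀ x y, x ≠ y → ‖K x y‖ ≤ C / ‖x - y‖ ^ d
  /-- Smoothness condition, on the gradients in each of the two variables. -/
  smoothness : ∃ C : ℝ, ∀ x y, x ≠ y →
    ‖fderiv ℝ (fun x' => K x' y) x‖ + ‖fderiv ℝ (fun y' => K x y') y‖ ≤ C / ‖x - y‖ ^ (d + 1)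

/-- A point of the lattice `ℤ^d`, as a point of Euclidean space. -/
noncomputable def latticePoint {d : ℕ} (n : Fin d → ℤ) : EuclideanSpace ℝ (Fin d) :=
  WithLp.toLp 2 fun i => (n i : ℝ)

/-- The terms, indexed by `m ≠ n`, of the series that defines `T_dis f (n)`. -/
noncomputable def discreteTerm {d : ℕ}
    (K : EuclideanSpace ℝ (Fin d) → EuclideanSpace ℝ (Fin d) → ℂ)
    (f : (Fin d → ℤ) → ℂ) (n : Fin d → ℤ) (m : {m : Fin d → ℤ // m ≠ n}) : ℂ :=
  K (latticePoint n) (latticePoint m.1) * f m.1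

/-- The discrete analogue `T_dis f (n) = ∑_{m ≠ n} K(n, m) f(m)`. -/
noncomputable def discreteAnalogue {d : ℕ}
    (K : EuclideanSpace ℝ (Fin d) → EuclideanSpace ℝ (Fin d) → ℂ)
    (f : (Fin d → ℤ) → ℂ) (n : Fin d → ℤ) : ℂ :=
  ∑' m : {m : Fin d → ℤ // m ≠ n}, discreteTerm K f n m

/-!
Pairing `T` with the lattice translates of a bump function supported near the origin recovers the
matrix `K(n, m)` up to an error which, by the smoothness of `K`, decays like `|n - m|` to a power
below `-d`. By Schur's test the error is bounded on `ℓ²`, and so is the matrix. The restriction of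
`K` to the lattice satisfies Hörmander's condition, so a Calderón–Zygmund decomposition on `ℤᵈ`
gives the weak type `(1, 1)`; interpolation covers `1 < p ≤ 2` and duality the remaining exponents.
-/

section MatrixTypes

variable {𝕜 ι κ : Type*} [RCLike 𝕜] {k l : ι → κ → 𝕜} {p q : ℝ} {A B C : ℝ≥0}

/-- The matrix `k` is of strong type `(p, p)`: it maps `ℓ^p(κ)` to `ℓ^p(ι)` with norm at most `C`.
The bound is required only for finite sections, so that no summability enters. -/
def HasStrongType (k : ι → κ → 𝕜) (p : ℝ) (C : ℝ≥0) : Prop :=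
  ∀ (N : Finset ι) (S : Finset κ) (f : κ → 𝕜),
    ∑ n ∈ N, ‖∑ m ∈ S, k n m * f m‖ ^ p ≤ C ^ p * ∑ m ∈ S, ‖f m‖ ^ p

/-- The matrix `k` is of weak type `(p, p)`: it maps `ℓ^p(κ)` to weak `ℓ^p(ι)` with constant `C`,
uniformly over finite sections. -/
def HasWeakType (k : ι → κ → 𝕜) (p : ℝ) (C : ℝ≥0) : Prop :=
  ∀ (N : Finset ι) (S : Finset κ) (f : κ → 𝕜) (t : ℝ), 0 < t →
    t ^ p * (N.filter fun n => t < ‖∑ m ∈ S, k n m * f m‖).card ≤ C ^ p * ∑ m ∈ S, ‖f m‖ ^ p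

theorem hasStrongType_iff_rpow_inv_le (hp : 0 < p) :
    HasStrongType k p C ↔ ∀ (N : Finset ι) (S : Finset κ) (f : κ → 𝕜),
      (∑ n ∈ N, ‖∑ m ∈ S, k n m * f m‖ ^ p) ^ p⁻¹ ≤ C * (∑ m ∈ S, ‖f m‖ ^ p) ^ p⁻¹ := by
  refine forall₃_congr fun N S f => ?_
  rw [Real.rpow_inv_le_iff_of_pos (by positivity) (by positivity) hp,
    Real.mul_rpow (by positivity) (by positivity), Real.rpow_inv_rpow (by positivity) hp.ne']

theorem mul_card_filter_lt_le_sum (N : Finset ι) {x : ι → ℝ} (hx : ∀ n, 0 ≤ x n) (t : ℝ) :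
    t * (N.filter fun n => t < x n).card ≤ ∑ n ∈ N, x n :=
  calc t * (N.filter fun n => t < x n).card = ∑ _n ∈ N.filter fun n => t < x n, t := by
        rw [Finset.sum_const, nsmul_eq_mul, mul_comm]
    _ ≤ ∑ n ∈ N.filter fun n => t < x n, x n :=
        Finset.sum_le_sum fun n hn => (Finset.mem_filter.mp hn).2.le
    _ ≤ ∑ n ∈ N, x n :=
        Finset.sum_le_sum_of_subset_of_nonneg (Finset.filter_subset _ _) fun n _ _ => hx n

theorem HasStrongType.hasWeakType (h : HasStrongType k p C) (hp : 0 < p) : HasWeakType k p C := by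
  intro N S f t ht
  refine le_trans ?_ (h N S f)
  simp_rw [← Real.rpow_lt_rpow_iff ht.le (norm_nonneg (∑ _m ∈ S, _)) hp]
  exact mul_card_filter_lt_le_sum N (fun _ => by positivity) _

theorem HasStrongType.norm_apply_le (h : HasStrongType k p C) (hp : 0 < p) (n : ι) (m : κ) :
    ‖k n m‖ ≤ C := by
  rw [← Real.rpow_le_rpow_iff (norm_nonneg _) C.coe_nonneg hp]
  simpa using h {n} {m} 1

theorem HasStrongType.const_mul (h : HasStrongType k p C) (a : 𝕜) :
    HasStrongType (fun n m => a * k n m) p (‖a‖₊ * C) := by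
  intro N S f
  simp_rw [mul_assoc, ← Finset.mul_sum, norm_mul, Real.mul_rpow (norm_nonneg _) (norm_nonneg _),
    ← Finset.mul_sum]
  rw [NNReal.coe_mul, coe_nnnorm, Real.mul_rpow (norm_nonneg _) C.coe_nonneg, mul_assoc]
  gcongr
  exact h N S f

theorem HasStrongType.add (hk : HasStrongType k p A) (hl : HasStrongType l p B) (hp : 1 ≤ p) :
    HasStrongType (fun n m => k n m + l n m) p (A + B) := by
  have hp0 : 0 < p := by linarith
  rw [hasStrongType_iff_rpow_inv_le hp0] at *
  intro N S f
  calc (∑ n ∈ N, ‖∑ m ∈ S, (k n m + l n m) * f m‖ ^ p) ^ p⁻¹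
      ≤ (∑ n ∈ N, (‖∑ m ∈ S, k n m * f m‖ + ‖∑ m ∈ S, l n m * f m‖) ^ p) ^ p⁻¹ := by
        simp_rw [add_mul, Finset.sum_add_distrib]
        gcongr
        exact norm_add_le _ _
    _ ≤ (∑ n ∈ N, ‖∑ m ∈ S, k n m * f m‖ ^ p) ^ p⁻¹
          + (∑ n ∈ N, ‖∑ m ∈ S, l n m * f m‖ ^ p) ^ p⁻¹ := by
        simpa only [one_div] using Real.Lp_add_le_of_nonneg N hp
          (fun _ _ => norm_nonneg (∑ m ∈ S, _)) fun _ _ => norm_nonneg (∑ m ∈ S, _)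
    _ ≤ ((A + B : ℝ≥0) : ℝ) * (∑ m ∈ S, ‖f m‖ ^ p) ^ p⁻¹ := by
        rw [NNReal.coe_add, add_mul]
        exact add_le_add (hk N S f) (hl N S f)

theorem exists_mul_eq_norm_rpow (hpq : p.HolderConjugate q) (z : 𝕜) :
    ∃ w : 𝕜, w * z = (‖z‖ ^ q : ℝ) ∧ ‖w‖ ^ p = ‖z‖ ^ q := by
  obtain ⟨c, hc, hcz⟩ := RCLike.exists_norm_eq_mul_self z
  refine ⟨(‖z‖ ^ (q - 1) : ℝ) * c, ?_, ?_⟩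
  · rw [mul_assoc, ← hcz, ← RCLike.ofReal_mul,
      ← Real.rpow_add_one' (norm_nonneg z) (by simpa using hpq.symm.ne_zero), sub_add_cancel]
  · rw [norm_mul, hc, mul_one, RCLike.norm_ofReal, abs_of_nonneg (by positivity),
      ← Real.rpow_mul (norm_nonneg z), hpq.symm.sub_one_mul_conj]

theorem norm_sum_mul_le_rpow_inv_mul_rpow_inv (hpq : p.HolderConjugate q) (s : Finset ι)
    (f g : ι → 𝕜) :
    ‖∑ i ∈ s, f i * g i‖ ≤ (∑ i ∈ s, ‖f i‖ ^ p) ^ p⁻¹ * (∑ i ∈ s, ‖g i‖ ^ q) ^ q⁻¹ := by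
  refine (norm_sum_le _ _).trans ?_
  simp only [norm_mul, ← one_div]
  exact Real.inner_le_Lp_mul_Lq_of_nonneg s hpq (fun _ _ => norm_nonneg _) fun _ _ => norm_nonneg _

theorem HasStrongType.flip (h : HasStrongType k p C) (hpq : p.HolderConjugate q) :
    HasStrongType (flip k) q C := by
  rw [hasStrongType_iff_rpow_inv_le hpq.pos] at h
  rw [hasStrongType_iff_rpow_inv_le hpq.symm.pos]
  intro S N f
  set x : κ → 𝕜 := fun m => ∑ n ∈ N, k n m * f n
  change (∑ m ∈ S, ‖x m‖ ^ q) ^ q⁻¹ ≤ _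
  choose w hw hw' using fun m => exists_mul_eq_norm_rpow hpq (x m)
  set X : ℝ := ∑ m ∈ S, ‖x m‖ ^ q with hX
  have hX0 : 0 ≤ X := by positivity
  have pairing : (X : 𝕜) = ∑ n ∈ N, (∑ m ∈ S, k n m * w m) * f n := by
    simp_rw [hX, RCLike.ofReal_sum, ← hw, x, Finset.mul_sum, Finset.sum_mul]
    rw [Finset.sum_comm]
    exact Finset.sum_congr rfl fun _ _ => Finset.sum_congr rfl fun _ _ => by ring
  have le_mul : X ≤ X ^ p⁻¹ * (C * (∑ n ∈ N, ‖f n‖ ^ q) ^ q⁻¹) :=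
    calc X = ‖(X : 𝕜)‖ := (RCLike.norm_of_nonneg hX0).symm
      _ ≤ (∑ n ∈ N, ‖∑ m ∈ S, k n m * w m‖ ^ p) ^ p⁻¹ * (∑ n ∈ N, ‖f n‖ ^ q) ^ q⁻¹ := by
          rw [pairing]
          exact norm_sum_mul_le_rpow_inv_mul_rpow_inv hpq _ _ _
      _ ≤ C * (∑ m ∈ S, ‖w m‖ ^ p) ^ p⁻¹ * (∑ n ∈ N, ‖f n‖ ^ q) ^ q⁻¹ := by
          gcongr
          exact h N S w
      _ = X ^ p⁻¹ * (C * (∑ n ∈ N, ‖f n‖ ^ q) ^ q⁻¹) := by simp_rw [hw']; ring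
  rcases hX0.eq_or_lt with hX0 | hXpos
  · rw [← hX0, Real.zero_rpow (inv_ne_zero hpq.symm.ne_zero)]
    positivity
  · refine le_of_mul_le_mul_left ?_ (Real.rpow_pos_of_pos hXpos p⁻¹)
    rwa [← Real.rpow_add hXpos, hpq.inv_add_inv_eq_one, Real.rpow_one]

theorem norm_sum_mul_rpow_le (hp : 1 ≤ p) (a f : κ → 𝕜) (S : Finset κ)
    (ha : ∑ m ∈ S, ‖a m‖ ≤ A) :
    ‖∑ m ∈ S, a m * f m‖ ^ p ≤ A ^ (p - 1) * ∑ m ∈ S, ‖a m‖ * ‖f m‖ ^ p := by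
  have hp0 : 0 < p := by linarith
  calc ‖∑ m ∈ S, a m * f m‖ ^ p ≤ (∑ m ∈ S, ‖a m‖ * ‖f m‖) ^ p := by
        gcongr
        simpa only [norm_mul] using norm_sum_le S fun m => a m * f m
    _ ≤ ((∑ m ∈ S, ‖a m‖) ^ (1 - p⁻¹) * (∑ m ∈ S, ‖a m‖ * ‖f m‖ ^ p) ^ p⁻¹) ^ p := by
        gcongr
        exact Real.inner_le_weight_mul_Lp_of_nonneg S hp _ _ (fun _ => norm_nonneg _)
          fun _ => norm_nonneg _
    _ = (∑ m ∈ S, ‖a m‖) ^ (p - 1) * ∑ m ∈ S, ‖a m‖ * ‖f m‖ ^ p := by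
        rw [Real.mul_rpow (by positivity) (by positivity), Real.rpow_inv_rpow (by positivity)
          hp0.ne', ← Real.rpow_mul (by positivity), sub_mul, one_mul, inv_mul_cancel₀ hp0.ne']
    _ ≤ A ^ (p - 1) * ∑ m ∈ S, ‖a m‖ * ‖f m‖ ^ p := by
        have := sub_nonneg.2 hp
        gcongr

theorem hasStrongType_of_sum_norm_le (hp : 1 ≤ p) (hrow : ∀ (S : Finset κ) n, ∑ m ∈ S, ‖k n m‖ ≤ A)
    (hcol : ∀ (N : Finset ι) m, ∑ n ∈ N, ‖k n m‖ ≤ A) : HasStrongType k p A := by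
  intro N S f
  calc ∑ n ∈ N, ‖∑ m ∈ S, k n m * f m‖ ^ p
      ≤ ∑ n ∈ N, A ^ (p - 1) * ∑ m ∈ S, ‖k n m‖ * ‖f m‖ ^ p :=
        Finset.sum_le_sum fun n _ => norm_sum_mul_rpow_le hp _ _ _ (hrow S n)
    _ = A ^ (p - 1) * ∑ m ∈ S, (∑ n ∈ N, ‖k n m‖) * ‖f m‖ ^ p := by
        rw [← Finset.mul_sum, Finset.sum_comm]
        simp only [Finset.sum_mul]
    _ ≤ A ^ (p - 1) * ∑ m ∈ S, A * ‖f m‖ ^ p := by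
        gcongr
        exact hcol N _
    _ = A ^ p * ∑ m ∈ S, ‖f m‖ ^ p := by
        rw [← Finset.mul_sum, ← mul_assoc,
          ← Real.rpow_add_one' A.coe_nonneg (by simpa using (by linarith : p ≠ 0)), sub_add_cancel]

end MatrixTypes

section Marcinkiewicz

variable {𝕜 ι κ : Type*} [RCLike 𝕜] {k : ι → κ → 𝕜} {p p₀ p₁ : ℝ} {A B : ℝ≥0}

theorem ofReal_sum_rpow_eq_lintegral_card (N : Finset ι) {x : ι → ℝ} (hx : ∀ n, 0 ≤ x n)
    (hp : 0 < p) :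
    ENNReal.ofReal (∑ n ∈ N, x n ^ p) = ENNReal.ofReal p *
      ∫⁻ t in Set.Ioi (0 : ℝ), (N.filter fun n => t < x n).card * ENNReal.ofReal (t ^ (p - 1)) := by
  let _ : MeasurableSpace ι := ⊤
  have h := lintegral_rpow_eq_lintegral_meas_lt_mul (∑ n ∈ N, Measure.dirac n)
    (Eventually.of_forall hx) Measurable.of_discrete.aemeasurable hp
  rw [lintegral_finsetSum_measure] at h
  simp only [lintegral_dirac, Measure.finsetSum_apply, Measure.dirac_apply, Set.indicator_apply,
    Set.mem_ofPred_eq, Pi.one_apply, Finset.sum_boole] at h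
  rw [ENNReal.ofReal_sum_of_nonneg fun n _ => Real.rpow_nonneg (hx n) p, h]

theorem card_filter_lt_norm_add_le {E : Type*} [SeminormedAddGroup E] (N : Finset ι) (x y : ι → E)
    (t : ℝ) :
    ((N.filter fun n => t < ‖x n + y n‖).card : ℝ) ≤
      (N.filter fun n => t / 2 < ‖x n‖).card + (N.filter fun n => t / 2 < ‖y n‖).card := by
  classical
  norm_cast
  refine (Finset.card_le_card fun n hn => ?_).trans (Finset.card_union_le _ _)
  simp only [Finset.mem_union, Finset.mem_filter] at hn ⊢
  by_contra! h
  linarith [hn.2, h.1 hn.1, h.2 hn.1, norm_add_le (x n) (y n)]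

theorem HasWeakType.card_le (h : HasWeakType k p A) (N : Finset ι) (S : Finset κ) (f : κ → 𝕜)
    {t : ℝ} (ht : 0 < t) :
    ((N.filter fun n => t < ‖∑ m ∈ S, k n m * f m‖).card : ℝ) ≤
      ∑ m ∈ S, A ^ p * ‖f m‖ ^ p * t ^ (-p) := by
  have := h N S f t ht
  rw [← Finset.sum_mul, ← Finset.mul_sum, Real.rpow_neg ht.le, ← div_eq_mul_inv,
    le_div_iff₀' (by positivity)]
  exact this

/-- The bound obtained for the contribution of a value `‖f m‖ = a` to the distribution function at
height `t`: the weak type `(p₀, p₀)` bound for the values above `t`, the weak type `(p₁, p₁)` bound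
for those below. -/
noncomputable def levelBound (p₀ p₁ : ℝ) (A B : ℝ≥0) (a t : ℝ) : ℝ :=
  if t < a then A ^ p₀ * a ^ p₀ * (t / 2) ^ (-p₀) else B ^ p₁ * a ^ p₁ * (t / 2) ^ (-p₁)

theorem card_filter_lt_le_sum_levelBound (h₀ : HasWeakType k p₀ A) (h₁ : HasWeakType k p₁ B)
    (hp₀ : p₀ ≠ 0) (hp₁ : p₁ ≠ 0) (N : Finset ι) (S : Finset κ) (f : κ → 𝕜) {t : ℝ} (ht : 0 < t) :
    ((N.filter fun n => t < ‖∑ m ∈ S, k n m * f m‖).card : ℝ) ≤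
      ∑ m ∈ S, levelBound p₀ p₁ A B ‖f m‖ t := by
  set high : κ → 𝕜 := fun m => if t < ‖f m‖ then f m else 0
  set low : κ → 𝕜 := fun m => if t < ‖f m‖ then 0 else f m
  have split : ∀ n, ∑ m ∈ S, k n m * f m = ∑ m ∈ S, k n m * high m + ∑ m ∈ S, k n m * low m := by
    intro n
    rw [← Finset.sum_add_distrib]
    refine Finset.sum_congr rfl fun m _ => ?_
    simp only [high, low]
    split_ifs <;> simp
  simp_rw [split]
  refine (card_filter_lt_norm_add_le N _ _ t).trans ((add_le_add
    (h₀.card_le N S high (half_pos ht)) (h₁.card_le N S low (half_pos ht))).trans_eq ?_)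
  rw [← Finset.sum_add_distrib]
  refine Finset.sum_congr rfl fun m _ => ?_
  simp only [high, low, levelBound]
  split_ifs <;> simp [Real.zero_rpow, hp₀, hp₁]

theorem lintegral_Ioo_zero_rpow {a r : ℝ} (ha : 0 ≤ a) (hr : -1 < r) :
    ∫⁻ t in Set.Ioo 0 a, ENNReal.ofReal (t ^ r) = ENNReal.ofReal (a ^ (r + 1) / (r + 1)) := by
  rw [restrict_Ioo_eq_restrict_Ioc, ← ofReal_integral_eq_lintegral_ofReal,
    ← intervalIntegral.integral_of_le ha, integral_rpow (Or.inl hr), Real.zero_rpow (by linarith),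
    sub_zero]
  · exact (intervalIntegrable_iff_integrableOn_Ioc_of_le ha).mp
      (intervalIntegral.intervalIntegrable_rpow' hr)
  · filter_upwards [ae_restrict_mem measurableSet_Ioc] with t ht using Real.rpow_nonneg ht.1.le r

theorem lintegral_Ici_rpow {a r : ℝ} (ha : 0 < a) (hr : r < -1) :
    ∫⁻ t in Set.Ici a, ENNReal.ofReal (t ^ r) = ENNReal.ofReal (-a ^ (r + 1) / (r + 1)) := by
  rw [← restrict_Ioi_eq_restrict_Ici,
    ← ofReal_integral_eq_lintegral_ofReal (integrableOn_Ioi_rpow_of_lt hr ha),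
    integral_Ioi_rpow_of_lt hr ha]
  filter_upwards [ae_restrict_mem measurableSet_Ioi] with t ht
    using Real.rpow_nonneg (ha.trans ht).le r

theorem mul_half_rpow_neg_mul_rpow_sub_one (c s : ℝ) {t : ℝ} (ht : 0 < t) :
    c * (t / 2) ^ (-s) * t ^ (p - 1) = c * 2 ^ s * t ^ (p - 1 - s) := by
  rw [Real.div_rpow ht.le zero_le_two, Real.rpow_neg zero_le_two, div_inv_eq_mul,
    sub_eq_add_neg _ s, Real.rpow_add ht]
  ring

theorem setLIntegral_ofReal_const_mul (s : Set ℝ) {c : ℝ} (hc : 0 ≤ c) (r : ℝ) :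
    ∫⁻ t in s, ENNReal.ofReal (c * t ^ r) =
      ENNReal.ofReal c * ∫⁻ t in s, ENNReal.ofReal (t ^ r) := by
  simp_rw [ENNReal.ofReal_mul hc]
  exact lintegral_const_mul _ (by fun_prop)

theorem lintegral_levelBound_mul_rpow_of_pos (h₀ : p₀ < p) (h₁ : p < p₁) {a : ℝ} (ha : 0 < a) :
    ∫⁻ t in Set.Ioi (0 : ℝ), ENNReal.ofReal (levelBound p₀ p₁ A B a t * t ^ (p - 1)) =
      ENNReal.ofReal (A ^ p₀ * 2 ^ p₀ / (p - p₀) + B ^ p₁ * 2 ^ p₁ / (p₁ - p)) *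
        ENNReal.ofReal (a ^ p) := by
  have hp₀ : 0 < p - p₀ := sub_pos.2 h₀
  have hp₁ : 0 < p₁ - p := sub_pos.2 h₁
  have low : ∫⁻ t in Set.Ioo 0 a, ENNReal.ofReal (levelBound p₀ p₁ A B a t * t ^ (p - 1)) =
      ENNReal.ofReal (A ^ p₀ * 2 ^ p₀ / (p - p₀) * a ^ p) := by
    calc _ = ∫⁻ t in Set.Ioo 0 a, ENNReal.ofReal (A ^ p₀ * a ^ p₀ * 2 ^ p₀ * t ^ (p - 1 - p₀)) :=
          setLIntegral_congr_fun measurableSet_Ioo fun t ht => by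
            simp only [levelBound, if_pos ht.2, mul_half_rpow_neg_mul_rpow_sub_one _ _ ht.1]
      _ = _ := by
          rw [setLIntegral_ofReal_const_mul _ (by positivity),
            lintegral_Ioo_zero_rpow ha.le (by linarith), ← ENNReal.ofReal_mul (by positivity),
            show p - 1 - p₀ + 1 = p - p₀ by ring, Real.rpow_sub ha]
          congr 1
          field_simp
  have high : ∫⁻ t in Set.Ici a, ENNReal.ofReal (levelBound p₀ p₁ A B a t * t ^ (p - 1)) =
      ENNReal.ofReal (B ^ p₁ * 2 ^ p₁ / (p₁ - p) * a ^ p) := by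
    calc _ = ∫⁻ t in Set.Ici a, ENNReal.ofReal (B ^ p₁ * a ^ p₁ * 2 ^ p₁ * t ^ (p - 1 - p₁)) :=
          setLIntegral_congr_fun measurableSet_Ici fun t ht => by
            simp only [levelBound, if_neg (Set.mem_Ici.1 ht).not_gt,
              mul_half_rpow_neg_mul_rpow_sub_one _ _ (ha.trans_le ht)]
      _ = _ := by
          rw [setLIntegral_ofReal_const_mul _ (by positivity), lintegral_Ici_rpow ha (by linarith),
            ← ENNReal.ofReal_mul (by positivity), show p - 1 - p₁ + 1 = -(p₁ - p) by ring,
            neg_div_neg_eq, neg_sub, Real.rpow_sub ha]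
          congr 1
          field_simp
  rw [← Set.Ioo_union_Ici_eq_Ioi ha, lintegral_union measurableSet_Ici
    (Set.disjoint_left.2 fun t ht ht' => ht.2.not_ge ht'), low, high,
    ← ENNReal.ofReal_add (by positivity) (by positivity), ← add_mul,
    ENNReal.ofReal_mul (by positivity)]

theorem measurable_levelBound (a : ℝ) : Measurable (levelBound p₀ p₁ A B a) :=
  Measurable.ite measurableSet_Iio (by fun_prop) (by fun_prop)

theorem levelBound_nonneg {a t : ℝ} (ha : 0 ≤ a) (ht : 0 ≤ t) :
    0 ≤ levelBound p₀ p₁ A B a t := by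
  unfold levelBound
  split_ifs <;> positivity

theorem lintegral_levelBound_mul_rpow (hp : 0 < p) (h₀ : p₀ < p) (h₁ : p < p₁) {a : ℝ}
    (ha : 0 ≤ a) :
    ∫⁻ t in Set.Ioi (0 : ℝ), ENNReal.ofReal (levelBound p₀ p₁ A B a t * t ^ (p - 1)) =
      ENNReal.ofReal (A ^ p₀ * 2 ^ p₀ / (p - p₀) + B ^ p₁ * 2 ^ p₁ / (p₁ - p)) *
        ENNReal.ofReal (a ^ p) := by
  rcases ha.eq_or_lt with rfl | ha
  · rw [setLIntegral_congr_fun (g := 0) measurableSet_Ioi fun t ht => ?_]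
    · simp [Real.zero_rpow hp.ne']
    · simp [levelBound, (Set.mem_Ioi.1 ht).not_gt, Real.zero_rpow (hp.trans h₁).ne']
  · exact lintegral_levelBound_mul_rpow_of_pos h₀ h₁ ha

theorem HasWeakType.exists_hasStrongType (hk₀ : HasWeakType k p₀ A) (hk₁ : HasWeakType k p₁ B)
    (hp₀ : 0 < p₀) (h₀ : p₀ < p) (h₁ : p < p₁) : ∃ C, HasStrongType k p C := by
  have hp : 0 < p := hp₀.trans h₀
  have := sub_pos.2 h₀
  have := sub_pos.2 h₁
  set D : ℝ := A ^ p₀ * 2 ^ p₀ / (p - p₀) + B ^ p₁ * 2 ^ p₁ / (p₁ - p)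
  have hD : 0 ≤ D := by positivity
  refine ⟨((p * D) ^ p⁻¹).toNNReal, fun N S f => ?_⟩
  rw [Real.coe_toNNReal _ (by positivity), Real.rpow_inv_rpow (by positivity) hp.ne',
    ← ENNReal.ofReal_le_ofReal_iff (by positivity), mul_assoc, ENNReal.ofReal_mul hp.le,
    ENNReal.ofReal_mul hD, ENNReal.ofReal_sum_of_nonneg (s := S) fun _ _ => by positivity,
    ofReal_sum_rpow_eq_lintegral_card N (fun _ => norm_nonneg _) hp, Finset.mul_sum]
  gcongr
  calc ∫⁻ t in Set.Ioi (0 : ℝ), (N.filter fun n => t < ‖∑ m ∈ S, k n m * f m‖).card *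
        ENNReal.ofReal (t ^ (p - 1))
      ≤ ∫⁻ t in Set.Ioi (0 : ℝ), ∑ m ∈ S,
          ENNReal.ofReal (levelBound p₀ p₁ A B ‖f m‖ t * t ^ (p - 1)) := by
        refine setLIntegral_mono' measurableSet_Ioi fun t (ht : 0 < t) => ?_
        rw [← ENNReal.ofReal_sum_of_nonneg fun m _ => mul_nonneg
          (levelBound_nonneg (norm_nonneg _) ht.le) (by positivity), ← Finset.sum_mul,
          ← ENNReal.ofReal_natCast, ← ENNReal.ofReal_mul (by positivity)]
        gcongr
        exact card_filter_lt_le_sum_levelBound hk₀ hk₁ hp₀.ne' (hp.trans h₁).ne' N S f ht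
    _ = ∑ m ∈ S, ENNReal.ofReal D * ENNReal.ofReal (‖f m‖ ^ p) := by
        have hmeas : ∀ m, Measurable fun t =>
            ENNReal.ofReal (levelBound p₀ p₁ A B ‖f m‖ t * t ^ (p - 1)) := fun m =>
          ((measurable_levelBound _).mul (by fun_prop)).ennreal_ofReal
        rw [lintegral_finsetSum _ fun m _ => hmeas m]
        simp only [lintegral_levelBound_mul_rpow hp h₀ h₁ (norm_nonneg _), D]

end Marcinkiewicz

section LatticeSums

variable {d : ℕ}

theorem one_le_norm_of_ne_zero {q : Fin d → ℤ} (hq : q ≠ 0) : 1 ≤ ‖q‖ := by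
  obtain ⟨i, hi⟩ := Function.ne_iff.mp hq
  refine le_trans ?_ (norm_le_pi_norm q i)
  rw [Int.norm_eq_abs]
  exact_mod_cast Int.one_le_abs hi

theorem card_filter_norm_sub_le (N : Finset (Fin d → ℤ)) (c : Fin d → ℤ) {R : ℝ} (hR : 0 ≤ R) :
    ((N.filter fun n => ‖n - c‖ ≤ R).card : ℝ) ≤ (2 * R + 1) ^ d := by
  have hsub : (N.filter fun n => ‖n - c‖ ≤ R) ⊆
      Fintype.piFinset fun i => Finset.Icc (c i - ⌊R⌋₊) (c i + ⌊R⌋₊) := by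
    intro n hn
    rw [Fintype.mem_piFinset]
    intro i
    have hi : |n i - c i| ≤ ⌊R⌋₊ := by
      have := (norm_le_pi_norm (n - c) i).trans (Finset.mem_filter.mp hn).2
      rwa [Int.norm_eq_abs, ← Int.cast_abs, ← Int.le_floor, ← Int.natCast_floor_eq_floor hR] at this
    rw [abs_le] at hi
    exact Finset.mem_Icc.2 ⟨by linarith, by linarith⟩
  have hcard : ∀ i, (Finset.Icc (c i - ⌊R⌋₊) (c i + ⌊R⌋₊)).card = 2 * ⌊R⌋₊ + 1 := fun i => by
    rw [Int.card_Icc]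
    omega
  calc ((N.filter fun n => ‖n - c‖ ≤ R).card : ℝ) ≤ (2 * ⌊R⌋₊ + 1) ^ d := by
        have := Finset.card_le_card hsub
        simp only [Fintype.card_piFinset, hcard, Finset.prod_const, Finset.card_univ,
          Fintype.card_fin] at this
        exact_mod_cast this
    _ ≤ (2 * R + 1) ^ d := by
        gcongr
        exact Nat.floor_le hR

theorem sum_norm_rpow_le_of_shell {δ r : ℝ} (hδ : 0 ≤ δ) (hr : 1 ≤ r) (N : Finset (Fin d → ℤ))
    (hN : ∀ n ∈ N, r ≤ ‖n‖ ∧ ‖n‖ ≤ 2 * r) :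
    ∑ n ∈ N, ‖n‖ ^ (-(d + δ)) ≤ 5 ^ d * r ^ (-δ) := by
  have hr0 : 0 < r := by linarith
  have hcard : (N.card : ℝ) ≤ (5 * r) ^ d :=
    calc (N.card : ℝ) ≤ (2 * (2 * r) + 1) ^ d := by
          simpa [Finset.filter_true_of_mem fun n hn => (hN n hn).2]
            using card_filter_norm_sub_le N 0 (by positivity : 0 ≤ 2 * r)
      _ ≤ (5 * r) ^ d := by
          gcongr
          linarith
  calc ∑ n ∈ N, ‖n‖ ^ (-(d + δ)) ≤ ∑ _n ∈ N, r ^ (-(d + δ)) :=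
        Finset.sum_le_sum fun n hn =>
          Real.rpow_le_rpow_of_nonpos hr0 (hN n hn).1 (by linarith [d.cast_nonneg (α := ℝ)])
    _ ≤ (5 * r) ^ d * r ^ (-(d + δ)) := by
        rw [Finset.sum_const, nsmul_eq_mul]
        gcongr
    _ = 5 ^ d * r ^ (-δ) := by
        rw [mul_pow, mul_assoc, ← Real.rpow_natCast r d, ← Real.rpow_add hr0, neg_add,
          add_neg_cancel_left]

theorem exists_sum_norm_rpow_le (d : ℕ) {δ : ℝ} (hδ : 0 < δ) :
    ∃ W : ℝ≥0, ∀ (R : ℝ), 1 ≤ R → ∀ N : Finset (Fin d → ℤ), (∀ n ∈ N, R ≤ ‖n‖) →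
      ∑ n ∈ N, ‖n‖ ^ (-(d + δ)) ≤ W * R ^ (-δ) := by
  classical
  have hgeom : Summable fun j : ℕ => ((2 : ℝ) ^ (-δ)) ^ j :=
    summable_geometric_of_lt_one (by positivity)
      (Real.rpow_lt_one_of_one_lt_of_neg one_lt_two (by linarith))
  refine ⟨(5 ^ d * ∑' j : ℕ, ((2 : ℝ) ^ (-δ)) ^ j).toNNReal, fun R hR N hN => ?_⟩
  have hR0 : 0 < R := by linarith
  have exists_shell : ∀ n, ∃ j : ℕ, n ∈ N → 2 ^ j * R ≤ ‖n‖ ∧ ‖n‖ ≤ 2 * (2 ^ j * R) := by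
    intro n
    by_cases hn : n ∈ N
    · obtain ⟨j, hj, hj'⟩ := exists_nat_pow_near ((one_le_div hR0).2 (hN n hn)) one_lt_two
      rw [pow_succ', div_lt_iff₀ hR0, mul_assoc] at hj'
      exact ⟨j, fun _ => ⟨(le_div_iff₀ hR0).1 hj, hj'.le⟩⟩
    · exact ⟨0, fun h => absurd h hn⟩
  choose shell hshell using exists_shell
  rw [Real.coe_toNNReal _ (by positivity),
    ← Finset.sum_fiberwise_of_maps_to fun n hn => Finset.mem_image_of_mem shell hn]
  calc ∑ j ∈ N.image shell, ∑ n ∈ N with shell n = j, ‖n‖ ^ (-(d + δ))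
      ≤ ∑ j ∈ N.image shell, 5 ^ d * (2 ^ j * R) ^ (-δ) := by
        refine Finset.sum_le_sum fun j _ => sum_norm_rpow_le_of_shell hδ.le ?_ _ fun n hn => ?_
        · exact one_le_mul_of_one_le_of_one_le (one_le_pow₀ one_le_two) hR
        · obtain ⟨hnN, rfl⟩ := Finset.mem_filter.1 hn
          exact hshell n hnN
    _ = 5 ^ d * (∑ j ∈ N.image shell, ((2 : ℝ) ^ (-δ)) ^ j) * R ^ (-δ) := by
        rw [Finset.mul_sum, Finset.sum_mul]
        refine Finset.sum_congr rfl fun j _ => ?_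
        rw [Real.mul_rpow (by positivity) hR0.le, Real.rpow_pow_comm zero_le_two, mul_assoc]
    _ ≤ 5 ^ d * (∑' j : ℕ, ((2 : ℝ) ^ (-δ)) ^ j) * R ^ (-δ) := by
        gcongr
        exact hgeom.sum_le_tsum _ fun _ _ => by positivity

theorem exists_sum_norm_sub_rpow_le (d : ℕ) {δ : ℝ} (hδ : 0 < δ) :
    ∃ W : ℝ≥0, ∀ (c : Fin d → ℤ) (R : ℝ), 1 ≤ R → ∀ N : Finset (Fin d → ℤ),
      (∀ n ∈ N, R ≤ ‖n - c‖) → ∑ n ∈ N, ‖n - c‖ ^ (-(d + δ)) ≤ W * R ^ (-δ) := by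
  obtain ⟨W, hW⟩ := exists_sum_norm_rpow_le d hδ
  refine ⟨W, fun c R hR N hN => ?_⟩
  simpa using hW R hR (N.map (Equiv.subRight c).toEmbedding) fun n hn => by
    simpa using hN (n + c) (by simpa using hn)

end LatticeSums

section CalderonZygmundDecomposition

variable {d : ℕ}

/-- The dyadic cube `∏ i, [2 ^ level * index i, 2 ^ level * (index i + 1))` of the lattice `ℤ^d`. -/
structure DyadicCube (d : ℕ) where
  /-- The binary logarithm of the side length. -/
  level : ℕ
  /-- The position of the cube among the dyadic cubes of the same level. -/
  index : Fin d → ℤ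

namespace DyadicCube

/-- The side length of a dyadic cube. -/
def side (Q : DyadicCube d) : ℕ := 2 ^ Q.level

/-- The corner with the smallest coordinates. -/
def corner (Q : DyadicCube d) : Fin d → ℤ := fun i => Q.side * Q.index i

/-- The set of lattice points of a dyadic cube. -/
noncomputable def points (Q : DyadicCube d) : Finset (Fin d → ℤ) :=
  Fintype.piFinset fun i => Finset.Ico (Q.corner i) (Q.corner i + Q.side)

/-- The dyadic cube of side `2 ^ k` to which `n` belongs. -/
def containing (k : ℕ) (n : Fin d → ℤ) : DyadicCube d := ⟨k, fun i => n i / 2 ^ k⟩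

theorem side_pos (Q : DyadicCube d) : 0 < Q.side := Nat.two_pow_pos _

theorem side_pow_pos (Q : DyadicCube d) : (0 : ℝ) < (Q.side : ℝ) ^ d :=
  pow_pos (Nat.cast_pos.2 Q.side_pos) d

theorem mem_points {Q : DyadicCube d} {n : Fin d → ℤ} :
    n ∈ Q.points ↔ containing Q.level n = Q := by
  obtain ⟨k, q⟩ := Q
  simp only [points, corner, side, containing, Fintype.mem_piFinset, Finset.mem_Ico, mk.injEq,
    true_and, funext_iff, Nat.cast_pow, Nat.cast_ofNat]
  refine forall_congr' fun i => ?_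
  rw [Int.ediv_eq_iff_of_pos (by positivity)]
  constructor <;> rintro ⟨h, h'⟩ <;> constructor <;> linarith

theorem mem_points_containing (k : ℕ) (n : Fin d → ℤ) : n ∈ (containing k n).points :=
  mem_points.2 rfl

theorem card_points (Q : DyadicCube d) : Q.points.card = Q.side ^ d := by
  simp [points, Fintype.card_piFinset]

theorem containing_eq_of_le {k l : ℕ} (hkl : k ≤ l) {n m : Fin d → ℤ}
    (h : containing k n = containing k m) : containing l n = containing l m := by
  obtain ⟨j, rfl⟩ := Nat.exists_eq_add_of_le hkl
  simp only [containing, mk.injEq, true_and, funext_iff] at h ⊢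
  intro i
  rw [pow_add, ← Int.ediv_ediv_of_nonneg (by positivity), h i,
    Int.ediv_ediv_of_nonneg (by positivity)]

theorem points_containing_subset_of_le {k l : ℕ} (hkl : k ≤ l) (n : Fin d → ℤ) :
    (containing k n).points ⊆ (containing l n).points := fun _ hm =>
  mem_points.2 (containing_eq_of_le hkl (mem_points.1 hm))

theorem norm_sub_corner_le {Q : DyadicCube d} {m : Fin d → ℤ} (hm : m ∈ Q.points) :
    ‖m - Q.corner‖ ≤ Q.side := by
  rw [pi_norm_le_iff_of_nonneg (by positivity)]
  intro i
  simp only [points, Fintype.mem_piFinset, Finset.mem_Ico] at hm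
  rw [Pi.sub_apply, Int.norm_eq_abs, ← Int.cast_abs, abs_of_nonneg (by linarith [hm i])]
  exact_mod_cast (by linarith [hm i] : m i - Q.corner i ≤ Q.side)

end DyadicCube

variable {𝕜 : Type*} [RCLike 𝕜] {f : (Fin d → ℤ) → 𝕜} {t : ℝ} {𝒬 : Finset (DyadicCube d)}
  {S : Finset (Fin d → ℤ)}

/-- The dyadic cubes on which the average of `‖f‖` exceeds `t`. -/
def IsHeavy (f : (Fin d → ℤ) → 𝕜) (t : ℝ) (Q : DyadicCube d) : Prop :=
  t * Q.side ^ d < ∑ m ∈ Q.points, ‖f m‖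

/-- The cubes selected by the Calderón–Zygmund stopping time: those on which the average of `‖f‖`
exceeds `t`, whereas it is at most `t` on each of their dyadic ancestors. -/
def IsMaximalHeavy (f : (Fin d → ℤ) → 𝕜) (t : ℝ) (Q : DyadicCube d) : Prop :=
  IsHeavy f t Q ∧ ∀ n ∈ Q.points, ∀ k, Q.level < k → ¬ IsHeavy f t (.containing k n)

theorem sum_norm_le_of_eq_zero (hf : ∀ m ∉ S, f m = 0) (P : Finset (Fin d → ℤ)) :
    ∑ m ∈ P, ‖f m‖ ≤ ∑ m ∈ S, ‖f m‖ := by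
  classical
  rw [← Finset.sum_inter_add_sum_sdiff P S, Finset.sum_eq_zero (s := P \ S) fun m hm => by
    rw [hf m (Finset.mem_sdiff.1 hm).2, norm_zero], add_zero]
  exact Finset.sum_le_sum_of_subset_of_nonneg Finset.inter_subset_right fun _ _ _ => norm_nonneg _

theorem exists_level_le_of_isHeavy (hd : d ≠ 0) (hf : ∀ m ∉ S, f m = 0) (ht : 0 < t) :
    ∃ K : ℕ, ∀ Q, IsHeavy f t Q → Q.level ≤ K := by
  obtain ⟨K, hK⟩ := exists_nat_ge ((∑ m ∈ S, ‖f m‖) / t)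
  refine ⟨K, fun Q hQ => ?_⟩
  have level_le : (Q.level : ℝ) ≤ Q.side ^ d := by
    exact_mod_cast Nat.lt_two_pow_self.le.trans (Nat.le_self_pow hd _)
  have : Q.level * t < K * t := calc
    Q.level * t ≤ t * Q.side ^ d := by rw [mul_comm]; gcongr
    _ < ∑ m ∈ S, ‖f m‖ := hQ.trans_le (sum_norm_le_of_eq_zero hf _)
    _ ≤ K * t := (div_le_iff₀ ht).1 hK
  exact_mod_cast (lt_of_mul_lt_mul_right this ht.le).le

theorem finite_setOf_isHeavy (hd : d ≠ 0) (hf : ∀ m ∉ S, f m = 0) (ht : 0 < t) :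
    {Q | IsHeavy f t Q}.Finite := by
  obtain ⟨K, hK⟩ := exists_level_le_of_isHeavy hd hf ht
  refine (((Set.finite_Iic K).prod S.finite_toSet).image
    fun x => DyadicCube.containing x.1 x.2).subset fun Q (hQ : IsHeavy f t Q) => ?_
  have sum_pos : 0 < ∑ m ∈ Q.points, ‖f m‖ := lt_of_le_of_lt (by positivity) hQ
  obtain ⟨m, hm, hfm⟩ := Finset.exists_ne_zero_of_sum_ne_zero sum_pos.ne'
  have hmS : m ∈ S := by_contra fun h => hfm (by rw [hf m h, norm_zero])
  exact ⟨(Q.level, m), ⟨hK Q hQ, hmS⟩, DyadicCube.mem_points.1 hm⟩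

theorem exists_isMaximalHeavy_of_isHeavy (hd : d ≠ 0) (hf : ∀ m ∉ S, f m = 0) (ht : 0 < t)
    {n : Fin d → ℤ} {k : ℕ} (h : IsHeavy f t (.containing k n)) :
    ∃ l, IsMaximalHeavy f t (.containing l n) := by
  have hfin : {l | IsHeavy f t (.containing l n)}.Finite :=
    (finite_setOf_isHeavy hd hf ht).preimage fun _ _ _ _ h => congrArg DyadicCube.level h
  obtain ⟨l, hl, hmax⟩ := Set.exists_max_image _ id hfin ⟨k, h⟩
  refine ⟨l, hl, fun m hm j hj hheavy => ?_⟩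
  rw [DyadicCube.containing_eq_of_le (le_of_lt hj) (DyadicCube.mem_points.1 hm)] at hheavy
  exact absurd (hmax j hheavy) (not_le.2 hj)

theorem IsMaximalHeavy.eq_of_mem {Q Q' : DyadicCube d} (hQ : IsMaximalHeavy f t Q)
    (hQ' : IsMaximalHeavy f t Q') {n : Fin d → ℤ} (hn : n ∈ Q.points) (hn' : n ∈ Q'.points) :
    Q = Q' := by
  have hnQ := DyadicCube.mem_points.1 hn
  have hnQ' := DyadicCube.mem_points.1 hn'
  rcases lt_trichotomy Q.level Q'.level with hlt | heq | hlt
  · exact absurd (hnQ' ▸ hQ'.1) (hQ.2 n hn _ hlt)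
  · rw [← hnQ, ← hnQ', heq]
  · exact absurd (hnQ ▸ hQ.1) (hQ'.2 n hn' _ hlt)

theorem IsMaximalHeavy.sum_norm_le {Q : DyadicCube d} (hQ : IsMaximalHeavy f t Q) :
    ∑ m ∈ Q.points, ‖f m‖ ≤ 2 ^ d * t * Q.side ^ d := by
  have hcorner : Q.corner ∈ Q.points := by
    simp [DyadicCube.points, Fintype.mem_piFinset, Q.side_pos]
  have hparent := hQ.2 _ hcorner _ Q.level.lt_succ_self
  rw [IsHeavy, not_lt] at hparent
  calc ∑ m ∈ Q.points, ‖f m‖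
      ≤ ∑ m ∈ (DyadicCube.containing (Q.level + 1) Q.corner).points, ‖f m‖ := by
        refine Finset.sum_le_sum_of_subset_of_nonneg ?_ fun _ _ _ => norm_nonneg _
        conv_lhs => rw [← DyadicCube.mem_points.1 hcorner]
        exact DyadicCube.points_containing_subset_of_le Q.level.le_succ _
    _ ≤ t * (2 ^ (Q.level + 1) : ℕ) ^ d := hparent
    _ = 2 ^ d * t * Q.side ^ d := by
        rw [DyadicCube.side, pow_succ, Nat.cast_mul, mul_pow, Nat.cast_ofNat]
        ring

/-- A finite family of dyadic cubes as selected by the Calderón–Zygmund stopping time for `f` at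
height `t`. -/
structure IsCalderonZygmundFamily (f : (Fin d → ℤ) → 𝕜) (t : ℝ) (𝒬 : Finset (DyadicCube d)) :
    Prop where
  pairwiseDisjoint : (𝒬 : Set (DyadicCube d)).PairwiseDisjoint DyadicCube.points
  isHeavy : ∀ Q ∈ 𝒬, IsHeavy f t Q
  sum_norm_le : ∀ Q ∈ 𝒬, ∑ m ∈ Q.points, ‖f m‖ ≤ 2 ^ d * t * Q.side ^ d
  norm_le_of_notMem : ∀ n, (∀ Q ∈ 𝒬, n ∉ Q.points) → ‖f n‖ ≤ t

theorem exists_isCalderonZygmundFamily (hd : d ≠ 0) (hf : ∀ m ∉ S, f m = 0) (ht : 0 < t) :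
    ∃ 𝒬, IsCalderonZygmundFamily f t 𝒬 := by
  have hfin : {Q | IsMaximalHeavy f t Q}.Finite :=
    (finite_setOf_isHeavy hd hf ht).subset fun _ hQ => hQ.1
  have mem_iff : ∀ Q, Q ∈ hfin.toFinset ↔ IsMaximalHeavy f t Q := fun Q => hfin.mem_toFinset
  refine ⟨hfin.toFinset, fun Q hQ Q' hQ' hne => ?_, fun Q hQ => ((mem_iff Q).1 hQ).1,
    fun Q hQ => ((mem_iff Q).1 hQ).sum_norm_le, fun n hn => ?_⟩
  · exact Finset.disjoint_left.2 fun m hm hm' =>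
      hne (((mem_iff Q).1 hQ).eq_of_mem ((mem_iff Q').1 hQ') hm hm')
  · by_contra! hlt
    have hheavy : IsHeavy f t (.containing 0 n) := by
      have := Finset.single_le_sum (f := fun m => ‖f m‖) (fun _ _ => norm_nonneg _)
        (DyadicCube.mem_points_containing 0 n)
      simpa [IsHeavy, DyadicCube.side, DyadicCube.containing] using hlt.trans_le this
    obtain ⟨l, hl⟩ := exists_isMaximalHeavy_of_isHeavy hd hf ht hheavy
    exact hn _ ((mem_iff _).2 hl) (DyadicCube.mem_points_containing l n)

/-- The average of `f` over the dyadic cube `Q`. -/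
noncomputable def cubeAverage (f : (Fin d → ℤ) → 𝕜) (Q : DyadicCube d) : 𝕜 :=
  (∑ m ∈ Q.points, f m) / Q.side ^ d

/-- The bad part of `f` on `Q`: the mean-zero function which is `f` minus its average on `Q`, and
zero off `Q`. -/
noncomputable def badPart (f : (Fin d → ℤ) → 𝕜) (Q : DyadicCube d) : (Fin d → ℤ) → 𝕜 :=
  Set.indicator Q.points fun m => f m - cubeAverage f Q

/-- The good part of `f`: what remains after removing the bad parts on the cubes of `𝒬`. -/
noncomputable def goodPart (f : (Fin d → ℤ) → 𝕜) (𝒬 : Finset (DyadicCube d)) :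
    (Fin d → ℤ) → 𝕜 :=
  fun m => f m - ∑ Q ∈ 𝒬, badPart f Q m

theorem badPart_of_mem {Q : DyadicCube d} {m : Fin d → ℤ} (hm : m ∈ Q.points) :
    badPart f Q m = f m - cubeAverage f Q :=
  Set.indicator_of_mem (Finset.mem_coe.2 hm) _

theorem badPart_of_notMem {Q : DyadicCube d} {m : Fin d → ℤ} (hm : m ∉ Q.points) :
    badPart f Q m = 0 :=
  Set.indicator_of_notMem (fun h => hm (Finset.mem_coe.1 h)) _

theorem norm_cubeAverage_le (f : (Fin d → ℤ) → 𝕜) (Q : DyadicCube d) :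
    ‖cubeAverage f Q‖ ≤ (∑ m ∈ Q.points, ‖f m‖) / Q.side ^ d := by
  rw [cubeAverage, norm_div, norm_pow, RCLike.norm_natCast]
  gcongr
  exact norm_sum_le _ _

theorem sum_badPart_eq_zero (f : (Fin d → ℤ) → 𝕜) (Q : DyadicCube d) :
    ∑ m ∈ Q.points, badPart f Q m = 0 := by
  have hside : ((Q.side : 𝕜) ^ d) ≠ 0 := pow_ne_zero _ (Nat.cast_ne_zero.2 Q.side_pos.ne')
  rw [Finset.sum_congr rfl fun m hm => badPart_of_mem hm, Finset.sum_sub_distrib,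
    Finset.sum_const, Q.card_points, nsmul_eq_mul, Nat.cast_pow, cubeAverage,
    mul_div_cancel₀ _ hside, sub_self]

theorem sum_norm_badPart_le (f : (Fin d → ℤ) → 𝕜) (Q : DyadicCube d) :
    ∑ m ∈ Q.points, ‖badPart f Q m‖ ≤ 2 * ∑ m ∈ Q.points, ‖f m‖ :=
  calc ∑ m ∈ Q.points, ‖badPart f Q m‖ ≤ ∑ m ∈ Q.points, (‖f m‖ + ‖cubeAverage f Q‖) :=
        Finset.sum_le_sum fun m hm => (badPart_of_mem (f := f) hm) ▸ norm_sub_le _ _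
    _ = ∑ m ∈ Q.points, ‖f m‖ + Q.side ^ d * ‖cubeAverage f Q‖ := by
        rw [Finset.sum_add_distrib, Finset.sum_const, Q.card_points, nsmul_eq_mul, Nat.cast_pow]
    _ ≤ ∑ m ∈ Q.points, ‖f m‖ + ∑ m ∈ Q.points, ‖f m‖ := by
        gcongr
        exact (le_div_iff₀' Q.side_pow_pos).1 (norm_cubeAverage_le f Q)
    _ = 2 * ∑ m ∈ Q.points, ‖f m‖ := (two_mul _).symm

namespace IsCalderonZygmundFamily

variable (h𝒬 : IsCalderonZygmundFamily f t 𝒬)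

include h𝒬

theorem norm_goodPart_le (ht : 0 ≤ t) (n : Fin d → ℤ) : ‖goodPart f 𝒬 n‖ ≤ 2 ^ d * t := by
  by_cases hn : ∃ Q ∈ 𝒬, n ∈ Q.points
  · obtain ⟨Q, hQ, hnQ⟩ := hn
    have hothers : ∀ Q' ∈ 𝒬, Q' ≠ Q → badPart f Q' n = 0 := fun Q' hQ' hne =>
      badPart_of_notMem (Finset.disjoint_right.1 (h𝒬.pairwiseDisjoint hQ' hQ hne) hnQ)
    rw [goodPart, Finset.sum_eq_single_of_mem Q hQ hothers, badPart_of_mem hnQ, sub_sub_cancel]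
    exact (norm_cubeAverage_le f Q).trans ((div_le_iff₀ Q.side_pow_pos).2 (h𝒬.sum_norm_le Q hQ))
  · push Not at hn
    rw [goodPart, Finset.sum_eq_zero fun Q hQ => badPart_of_notMem (hn Q hQ), sub_zero]
    exact (h𝒬.norm_le_of_notMem n hn).trans
      (le_mul_of_one_le_left ht (one_le_pow₀ one_le_two))

variable (hS : ∀ Q ∈ 𝒬, Q.points ⊆ S)

include hS

theorem sum_sum_points_norm_le : ∑ Q ∈ 𝒬, ∑ m ∈ Q.points, ‖f m‖ ≤ ∑ m ∈ S, ‖f m‖ := by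
  classical
  rw [← Finset.sum_biUnion h𝒬.pairwiseDisjoint]
  exact Finset.sum_le_sum_of_subset_of_nonneg (Finset.biUnion_subset.2 hS) fun _ _ _ =>
    norm_nonneg _

theorem mul_sum_side_pow_le : t * ∑ Q ∈ 𝒬, (Q.side : ℝ) ^ d ≤ ∑ m ∈ S, ‖f m‖ := by
  rw [Finset.mul_sum]
  exact (Finset.sum_le_sum fun Q hQ => (h𝒬.isHeavy Q hQ).le).trans (h𝒬.sum_sum_points_norm_le hS)

theorem sum_sum_norm_badPart_le :
    ∑ Q ∈ 𝒬, ∑ m ∈ Q.points, ‖badPart f Q m‖ ≤ 2 * ∑ m ∈ S, ‖f m‖ :=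
  calc ∑ Q ∈ 𝒬, ∑ m ∈ Q.points, ‖badPart f Q m‖ ≤ ∑ Q ∈ 𝒬, 2 * ∑ m ∈ Q.points, ‖f m‖ :=
        Finset.sum_le_sum fun Q _ => sum_norm_badPart_le f Q
    _ ≤ 2 * ∑ m ∈ S, ‖f m‖ := by
        rw [← Finset.mul_sum]
        gcongr
        exact h𝒬.sum_sum_points_norm_le hS

theorem sum_norm_goodPart_le : ∑ m ∈ S, ‖goodPart f 𝒬 m‖ ≤ 3 * ∑ m ∈ S, ‖f m‖ :=
  calc ∑ m ∈ S, ‖goodPart f 𝒬 m‖ ≤ ∑ m ∈ S, (‖f m‖ + ∑ Q ∈ 𝒬, ‖badPart f Q m‖) :=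
        Finset.sum_le_sum fun m _ => (norm_sub_le _ _).trans (by gcongr; exact norm_sum_le _ _)
    _ = ∑ m ∈ S, ‖f m‖ + ∑ Q ∈ 𝒬, ∑ m ∈ Q.points, ‖badPart f Q m‖ := by
        rw [Finset.sum_add_distrib, Finset.sum_comm]
        congr 1
        refine Finset.sum_congr rfl fun Q hQ => (Finset.sum_subset (hS Q hQ) fun m _ hm => ?_).symm
        rw [badPart_of_notMem hm, norm_zero]
    _ ≤ 3 * ∑ m ∈ S, ‖f m‖ := by linarith [h𝒬.sum_sum_norm_badPart_le hS]

end IsCalderonZygmundFamily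

end CalderonZygmundDecomposition

section WeakTypeBound

variable {d : ℕ} {𝕜 : Type*} [RCLike 𝕜] {k : (Fin d → ℤ) → (Fin d → ℤ) → 𝕜}
  {L B C C' : ℝ≥0}

/-- Hörmander's regularity condition on a matrix over `ℤ^d`: an increment of the column index from
`c` to `m` changes the columns by at most `C` in `ℓ¹`, away from the ball of radius `L * ‖m - c‖`
about `c`. -/
def HormanderCondition (k : (Fin d → ℤ) → (Fin d → ℤ) → 𝕜) (L C : ℝ≥0) : Prop :=
  ∀ (c m : Fin d → ℤ) (N : Finset (Fin d → ℤ)), (∀ n ∈ N, L * ‖m - c‖ < ‖n - c‖) →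
    ∑ n ∈ N, ‖k n m - k n c‖ ≤ C

theorem HormanderCondition.sum_norm_sum_mul_le (hk : HormanderCondition k L C) {Q : DyadicCube d}
    {b : (Fin d → ℤ) → 𝕜} (hb : ∑ m ∈ Q.points, b m = 0) {N : Finset (Fin d → ℤ)}
    (hN : ∀ n ∈ N, L * Q.side < ‖n - Q.corner‖) :
    ∑ n ∈ N, ‖∑ m ∈ Q.points, k n m * b m‖ ≤ C * ∑ m ∈ Q.points, ‖b m‖ := by
  have cancel : ∀ n, ∑ m ∈ Q.points, k n m * b m
      = ∑ m ∈ Q.points, (k n m - k n Q.corner) * b m := fun n => by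
    simp only [sub_mul, Finset.sum_sub_distrib, ← Finset.mul_sum, hb, mul_zero, sub_zero]
  calc ∑ n ∈ N, ‖∑ m ∈ Q.points, k n m * b m‖
      ≤ ∑ n ∈ N, ∑ m ∈ Q.points, ‖k n m - k n Q.corner‖ * ‖b m‖ := by
        refine Finset.sum_le_sum fun n _ => ?_
        rw [cancel]
        simpa only [norm_mul] using norm_sum_le Q.points fun m => (k n m - k n Q.corner) * b m
    _ = ∑ m ∈ Q.points, (∑ n ∈ N, ‖k n m - k n Q.corner‖) * ‖b m‖ := by
        rw [Finset.sum_comm]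
        simp only [Finset.sum_mul]
    _ ≤ ∑ m ∈ Q.points, C * ‖b m‖ := by
        refine Finset.sum_le_sum fun m hm => ?_
        gcongr
        refine hk Q.corner m N fun n hn => lt_of_le_of_lt ?_ (hN n hn)
        gcongr
        exact DyadicCube.norm_sub_corner_le hm
    _ = C * ∑ m ∈ Q.points, ‖b m‖ := Finset.mul_sum .. |>.symm

theorem card_le_of_forall_exists_norm_sub_corner_le {𝒬 : Finset (DyadicCube d)}
    {N : Finset (Fin d → ℤ)} (hN : ∀ n ∈ N, ∃ Q ∈ 𝒬, ‖n - Q.corner‖ ≤ L * Q.side) :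
    (N.card : ℝ) ≤ (2 * L + 1) ^ d * ∑ Q ∈ 𝒬, (Q.side : ℝ) ^ d := by
  classical
  have hsub : N ⊆ 𝒬.biUnion fun Q : DyadicCube d =>
      N.filter fun n => ‖n - Q.corner‖ ≤ L * Q.side := by
    intro n hn
    obtain ⟨Q, hQ, hnQ⟩ := hN n hn
    exact Finset.mem_biUnion.2 ⟨Q, hQ, Finset.mem_filter.2 ⟨hn, hnQ⟩⟩
  calc (N.card : ℝ) ≤ ∑ Q ∈ 𝒬, ((N.filter fun n => ‖n - Q.corner‖ ≤ L * Q.side).card : ℝ) := by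
        exact_mod_cast (Finset.card_le_card hsub).trans Finset.card_biUnion_le
    _ ≤ ∑ Q ∈ 𝒬, ((2 * L + 1) * Q.side : ℝ) ^ d := by
        refine Finset.sum_le_sum fun Q _ => ?_
        refine (card_filter_norm_sub_le N Q.corner (by positivity)).trans ?_
        have : (1 : ℝ) ≤ Q.side := by exact_mod_cast Q.side_pos
        gcongr
        linarith
    _ = (2 * L + 1) ^ d * ∑ Q ∈ 𝒬, (Q.side : ℝ) ^ d := by
        simp only [mul_pow, Finset.mul_sum]

namespace IsCalderonZygmundFamily

variable {f : (Fin d → ℤ) → 𝕜} {t : ℝ} {𝒬 : Finset (DyadicCube d)} {N S : Finset (Fin d → ℤ)}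
  (h𝒬 : IsCalderonZygmundFamily f t 𝒬) (hS : ∀ Q ∈ 𝒬, Q.points ⊆ S)

include h𝒬 hS

theorem mul_card_near_le (ht : 0 < t)
    (hN : ∀ n ∈ N, ∃ Q ∈ 𝒬, ‖n - Q.corner‖ ≤ L * Q.side) :
    t * N.card ≤ (2 * L + 1) ^ d * ∑ m ∈ S, ‖f m‖ :=
  calc t * N.card ≤ t * ((2 * L + 1) ^ d * ∑ Q ∈ 𝒬, (Q.side : ℝ) ^ d) := by
        gcongr
        exact card_le_of_forall_exists_norm_sub_corner_le hN
    _ = (2 * L + 1) ^ d * (t * ∑ Q ∈ 𝒬, (Q.side : ℝ) ^ d) := by ring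
    _ ≤ (2 * L + 1) ^ d * ∑ m ∈ S, ‖f m‖ := by
        gcongr
        exact h𝒬.mul_sum_side_pow_le hS

theorem sum_norm_goodPart_sq_le (ht : 0 < t) :
    ∑ m ∈ S, ‖goodPart f 𝒬 m‖ ^ 2 ≤ 2 ^ d * t * (3 * ∑ m ∈ S, ‖f m‖) :=
  calc ∑ m ∈ S, ‖goodPart f 𝒬 m‖ ^ 2 ≤ ∑ m ∈ S, 2 ^ d * t * ‖goodPart f 𝒬 m‖ := by
        refine Finset.sum_le_sum fun m _ => ?_
        rw [pow_two]
        gcongr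
        exact h𝒬.norm_goodPart_le ht.le m
    _ ≤ 2 ^ d * t * (3 * ∑ m ∈ S, ‖f m‖) := by
        rw [← Finset.mul_sum]
        gcongr
        exact h𝒬.sum_norm_goodPart_le hS

theorem mul_card_goodPart_le (hk : HasWeakType k 2 B) (N : Finset (Fin d → ℤ)) (ht : 0 < t) :
    t * (N.filter fun n => t / 2 < ‖∑ m ∈ S, k n m * goodPart f 𝒬 m‖).card ≤
      12 * 2 ^ d * B ^ 2 * ∑ m ∈ S, ‖f m‖ := by
  have weak := hk N S (goodPart f 𝒬) (t / 2) (by positivity)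
  simp only [Real.rpow_two] at weak
  have bound := weak.trans
    (mul_le_mul_of_nonneg_left (h𝒬.sum_norm_goodPart_sq_le hS ht) (sq_nonneg _))
  refine le_of_mul_le_mul_left ?_ (show 0 < t / 4 by positivity)
  linarith

theorem sum_norm_sum_mul_badPart_le (hk : HormanderCondition k L C)
    (hN : ∀ n ∈ N, ∀ Q ∈ 𝒬, L * Q.side < ‖n - Q.corner‖) :
    ∑ n ∈ N, ‖∑ m ∈ S, k n m * ∑ Q ∈ 𝒬, badPart f Q m‖ ≤ C * (2 * ∑ m ∈ S, ‖f m‖) :=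
  calc ∑ n ∈ N, ‖∑ m ∈ S, k n m * ∑ Q ∈ 𝒬, badPart f Q m‖
      ≤ ∑ n ∈ N, ∑ Q ∈ 𝒬, ‖∑ m ∈ Q.points, k n m * badPart f Q m‖ := by
        refine Finset.sum_le_sum fun n _ => ?_
        simp only [Finset.mul_sum]
        rw [Finset.sum_comm]
        refine (norm_sum_le _ _).trans_eq (Finset.sum_congr rfl fun Q hQ => congrArg _ ?_)
        exact (Finset.sum_subset (hS Q hQ) fun m _ hm => by
          rw [badPart_of_notMem hm, mul_zero]).symm
    _ = ∑ Q ∈ 𝒬, ∑ n ∈ N, ‖∑ m ∈ Q.points, k n m * badPart f Q m‖ := Finset.sum_comm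
    _ ≤ ∑ Q ∈ 𝒬, C * ∑ m ∈ Q.points, ‖badPart f Q m‖ :=
        Finset.sum_le_sum fun Q hQ =>
          hk.sum_norm_sum_mul_le (sum_badPart_eq_zero f Q) fun n hn => hN n hn Q hQ
    _ ≤ C * (2 * ∑ m ∈ S, ‖f m‖) := by
        rw [← Finset.mul_sum]
        gcongr
        exact h𝒬.sum_sum_norm_badPart_le hS

theorem mul_card_badPart_le (hk : HormanderCondition k L C)
    (hN : ∀ n ∈ N, ∀ Q ∈ 𝒬, L * Q.side < ‖n - Q.corner‖) :
    t * (N.filter fun n => t / 2 < ‖∑ m ∈ S, k n m * ∑ Q ∈ 𝒬, badPart f Q m‖).card ≤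
      4 * C * ∑ m ∈ S, ‖f m‖ := by
  have chebyshev := mul_card_filter_lt_le_sum N
    (fun n => norm_nonneg (∑ m ∈ S, k n m * ∑ Q ∈ 𝒬, badPart f Q m)) (t / 2)
  linarith [h𝒬.sum_norm_sum_mul_badPart_le hS hk hN]

theorem mul_card_far_le (hk : HormanderCondition k L C) (hk₂ : HasWeakType k 2 B) (ht : 0 < t)
    (hN : ∀ n ∈ N, ∀ Q ∈ 𝒬, L * Q.side < ‖n - Q.corner‖) :
    t * (N.filter fun n => t < ‖∑ m ∈ S, k n m * f m‖).card ≤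
      (12 * 2 ^ d * B ^ 2 + 4 * C) * ∑ m ∈ S, ‖f m‖ := by
  have split : ∀ n, ∑ m ∈ S, k n m * f m =
      ∑ m ∈ S, k n m * goodPart f 𝒬 m + ∑ m ∈ S, k n m * ∑ Q ∈ 𝒬, badPart f Q m := fun n => by
    simp only [← Finset.sum_add_distrib, ← mul_add, goodPart, sub_add_cancel]
  simp only [split]
  refine (mul_le_mul_of_nonneg_left (card_filter_lt_norm_add_le N _ _ t) ht.le).trans ?_
  linarith [h𝒬.mul_card_goodPart_le hS hk₂ N ht, h𝒬.mul_card_badPart_le hS hk hN]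

theorem mul_card_le (hk : HormanderCondition k L C) (hk₂ : HasWeakType k 2 B) (ht : 0 < t)
    (N : Finset (Fin d → ℤ)) :
    t * (N.filter fun n => t < ‖∑ m ∈ S, k n m * f m‖).card ≤
      ((2 * L + 1) ^ d + 12 * 2 ^ d * B ^ 2 + 4 * C) * ∑ m ∈ S, ‖f m‖ := by
  classical
  set near : (Fin d → ℤ) → Prop := fun n => ∃ Q ∈ 𝒬, ‖n - Q.corner‖ ≤ L * Q.side
  have hnear := h𝒬.mul_card_near_le hS (L := L) (N := N.filter near) ht fun n hn =>
    (Finset.mem_filter.1 hn).2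
  have hfar := h𝒬.mul_card_far_le hS (N := N.filter fun n => ¬ near n) hk hk₂ ht fun n hn Q hQ =>
    not_le.1 fun h => (Finset.mem_filter.1 hn).2 ⟨Q, hQ, h⟩
  have card_le : (N.filter fun n => t < ‖∑ m ∈ S, k n m * f m‖).card ≤ (N.filter near).card +
      ((N.filter fun n => ¬ near n).filter fun n => t < ‖∑ m ∈ S, k n m * f m‖).card := by
    rw [Finset.filter_comm, ← Finset.card_filter_add_card_filter_not near]
    gcongr
    exact Finset.filter_subset _ _
  have := mul_le_mul_of_nonneg_left (Nat.cast_le (α := ℝ).2 card_le) ht.le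
  push_cast at this
  linarith

end IsCalderonZygmundFamily

theorem HormanderCondition.hasWeakType_one (hd : d ≠ 0) (hk : HormanderCondition k L C)
    (hk₂ : HasWeakType k 2 B) :
    HasWeakType k 1 ((2 * L + 1) ^ d + 12 * 2 ^ d * B ^ 2 + 4 * C) := by
  classical
  intro N S f t ht
  set g : (Fin d → ℤ) → 𝕜 := fun m => if m ∈ S then f m else 0
  have hg : ∀ m ∈ S, g m = f m := fun m hm => if_pos hm
  have hgS : ∀ m ∉ S, g m = 0 := fun m hm => if_neg hm
  obtain ⟨𝒬, h𝒬⟩ := exists_isCalderonZygmundFamily hd hgS ht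
  set U := S ∪ 𝒬.biUnion DyadicCube.points
  have hU : ∀ Q ∈ 𝒬, Q.points ⊆ U := fun Q hQ =>
    (Finset.subset_biUnion_of_mem _ hQ).trans Finset.subset_union_right
  have sum_eq : ∀ n, ∑ m ∈ S, k n m * f m = ∑ m ∈ U, k n m * g m := fun n =>
    (Finset.sum_congr rfl fun m hm => by rw [hg m hm]).trans
      (Finset.sum_subset Finset.subset_union_left fun m _ hm => by rw [hgS m hm, mul_zero])
  have sum_norm_eq : ∑ m ∈ S, ‖f m‖ = ∑ m ∈ U, ‖g m‖ :=
    (Finset.sum_congr rfl fun m hm => by rw [hg m hm]).trans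
      (Finset.sum_subset Finset.subset_union_left fun m _ hm => by rw [hgS m hm, norm_zero])
  simp only [Real.rpow_one, sum_eq, sum_norm_eq]
  exact_mod_cast h𝒬.mul_card_le hU hk hk₂ ht N

theorem HormanderCondition.exists_hasStrongType_of_lt_two (hd : d ≠ 0)
    (hk : HormanderCondition k L C) (hk₂ : HasStrongType k 2 B) {p : ℝ} (hp : 1 < p) (hp₂ : p < 2) :
    ∃ A, HasStrongType k p A :=
  (hk.hasWeakType_one hd (hk₂.hasWeakType two_pos)).exists_hasStrongType
    (hk₂.hasWeakType two_pos) one_pos hp hp₂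

theorem HormanderCondition.exists_hasStrongType (hd : d ≠ 0) (hk : HormanderCondition k L C)
    (hk' : HormanderCondition (flip k) L C') (hk₂ : HasStrongType k 2 B) {p : ℝ} (hp : 1 < p) :
    ∃ A, HasStrongType k p A := by
  rcases lt_trichotomy p 2 with hlt | rfl | hgt
  · exact hk.exists_hasStrongType_of_lt_two hd hk₂ hp hlt
  · exact ⟨B, hk₂⟩
  · have hpq := Real.HolderConjugate.conjExponent hp
    have hq : p.conjExponent < 2 := by
      rw [Real.conjExponent, div_lt_iff₀ (by linarith)]
      linarith
    obtain ⟨A, hA⟩ := hk'.exists_hasStrongType_of_lt_two hd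
      (hk₂.flip Real.HolderConjugate.two_two) hpq.symm.lt hq
    exact ⟨A, hA.flip hpq.symm⟩

end WeakTypeBound

section HolderKernels

variable {d : ℕ} {𝕜 : Type*} [RCLike 𝕜]
  {K : EuclideanSpace ℝ (Fin d) → EuclideanSpace ℝ (Fin d) → 𝕜} {δ : ℝ} {C : ℝ≥0}

/-- The Calderón–Zygmund condition of Hölder exponent `δ` in the second variable of the kernel `K`:
at distance `R` from `x`, the function `K x` varies by at most `C * h ^ δ / R ^ (d + δ)` over
distances `h ≤ R / 2`. -/
def IsHolderKernel (K : EuclideanSpace ℝ (Fin d) → EuclideanSpace ℝ (Fin d) → 𝕜) (δ : ℝ)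
    (C : ℝ≥0) : Prop :=
  ∀ x y y', 2 * ‖y' - y‖ ≤ ‖x - y‖ →
    ‖K x y' - K x y‖ ≤ C * ‖y' - y‖ ^ δ * ‖x - y‖ ^ (-(d + δ))

theorem IsHolderKernel.norm_sub_le (hK : IsHolderKernel K δ C) (hδ : 0 ≤ δ) {h r : ℝ} (hr : 0 < r)
    {x y y' : EuclideanSpace ℝ (Fin d)} (hhalf : 2 * ‖y' - y‖ ≤ ‖x - y‖) (hh : ‖y' - y‖ ≤ h)
    (hrx : r ≤ ‖x - y‖) : ‖K x y' - K x y‖ ≤ C * h ^ δ * r ^ (-(d + δ)) := by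
  have := Real.rpow_le_rpow_of_nonpos hr hrx
    (by linarith [d.cast_nonneg (α := ℝ)] : -(d + δ) ≤ 0)
  have hh0 : 0 ≤ h := (norm_nonneg _).trans hh
  refine (hK x y y' hhalf).trans ?_
  gcongr

theorem IsHolderKernel.continuousAt (hK : IsHolderKernel K δ C) (hδ : 0 < δ)
    {x y : EuclideanSpace ℝ (Fin d)} (hxy : x ≠ y) : ContinuousAt (K x) y := by
  have hpos : 0 < ‖x - y‖ / 2 := half_pos (norm_pos_iff.2 (sub_ne_zero.2 hxy))
  have modulus_tendsto : Tendsto (fun y' => C * ‖y' - y‖ ^ δ * ‖x - y‖ ^ (-(d + δ))) (𝓝 y)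
      (𝓝 0) := by
    have : ContinuousAt (fun y' => C * ‖y' - y‖ ^ δ * ‖x - y‖ ^ (-(d + δ))) y := by
      fun_prop (disch := positivity)
    simpa [ContinuousAt, Real.zero_rpow hδ.ne'] using this
  refine tendsto_iff_norm_sub_tendsto_zero.2 (squeeze_zero' (.of_forall fun _ => norm_nonneg _) ?_
    modulus_tendsto)
  filter_upwards [Metric.ball_mem_nhds y hpos] with y' hy'
  rw [mem_ball_iff_norm] at hy'
  exact hK x y y' (by linarith)

end HolderKernels

section LatticeMatrix

variable {d : ℕ} {𝕜 : Type*} [RCLike 𝕜]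
  {K : EuclideanSpace ℝ (Fin d) → EuclideanSpace ℝ (Fin d) → 𝕜} {δ : ℝ} {C : ℝ≥0}

theorem latticePoint_sub (n m : Fin d → ℤ) :
    latticePoint (n - m) = latticePoint n - latticePoint m := by
  ext i
  simp [latticePoint]

theorem norm_le_norm_latticePoint (q : Fin d → ℤ) : ‖q‖ ≤ ‖latticePoint q‖ := by
  refine (pi_norm_le_iff_of_nonneg (norm_nonneg _)).2 fun i => ?_
  simpa [latticePoint, Int.norm_eq_abs] using PiLp.norm_apply_le (latticePoint q) i

theorem norm_latticePoint_le (q : Fin d → ℤ) : ‖latticePoint q‖ ≤ d * ‖q‖ := by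
  have norm_apply_le : ∀ i, ‖latticePoint q i‖ ≤ ‖q‖ := fun i => by
    simpa [latticePoint, Int.norm_eq_abs] using norm_le_pi_norm q i
  rw [EuclideanSpace.norm_eq]
  refine Real.sqrt_le_iff.2 ⟨by positivity, ?_⟩
  calc ∑ i, ‖latticePoint q i‖ ^ 2 ≤ ∑ _i : Fin d, ‖q‖ ^ 2 := by
        gcongr with i
        exact norm_apply_le i
    _ = d * ‖q‖ ^ 2 := by simp
    _ ≤ (d * ‖q‖) ^ 2 := by
        rw [mul_pow]
        gcongr
        exact_mod_cast Nat.le_self_pow two_ne_zero d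

theorem norm_sub_le_norm_latticePoint_sub (n m : Fin d → ℤ) :
    ‖n - m‖ ≤ ‖latticePoint n - latticePoint m‖ :=
  latticePoint_sub n m ▸ norm_le_norm_latticePoint _

theorem half_norm_sub_le_norm_sub_latticePoint {n m : Fin d → ℤ} (hnm : n ≠ m)
    {x : EuclideanSpace ℝ (Fin d)} (hx : ‖x - latticePoint n‖ ≤ 1 / 4) :
    ‖n - m‖ / 2 ≤ ‖x - latticePoint m‖ := by
  have := norm_sub_le_norm_sub_add_norm_sub (latticePoint n) x (latticePoint m)
  rw [norm_sub_rev (latticePoint n) x] at this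
  linarith [one_le_norm_of_ne_zero (sub_ne_zero.2 hnm), norm_sub_le_norm_latticePoint_sub n m]

/-- The matrix of the discrete analogue of the operator with kernel `K`: the kernel restricted to
the lattice `ℤ^d`, with zeros on the diagonal. -/
noncomputable def latticeMatrix (K : EuclideanSpace ℝ (Fin d) → EuclideanSpace ℝ (Fin d) → 𝕜)
    (n m : Fin d → ℤ) : 𝕜 :=
  if n = m then 0 else K (latticePoint n) (latticePoint m)

theorem latticeMatrix_self (n : Fin d → ℤ) : latticeMatrix K n n = 0 := if_pos rfl

theorem latticeMatrix_of_ne {n m : Fin d → ℤ} (h : n ≠ m) :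
    latticeMatrix K n m = K (latticePoint n) (latticePoint m) := if_neg h

theorem latticeMatrix_flip : latticeMatrix (flip K) = flip (latticeMatrix K) := by
  ext n m
  simp only [latticeMatrix, flip, eq_comm]

theorem IsHolderKernel.norm_latticeMatrix_sub_le (hK : IsHolderKernel K δ C) (hδ : 0 ≤ δ)
    {c m n : Fin d → ℤ} (hn : (2 * d + 1) * ‖m - c‖ < ‖n - c‖) :
    ‖latticeMatrix K n m - latticeMatrix K n c‖ ≤
      C * (d * ‖m - c‖) ^ δ * ‖n - c‖ ^ (-(d + δ)) := by
  have hdm : 0 ≤ d * ‖m - c‖ := by positivity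
  have hnc : 0 < ‖n - c‖ := by linarith [norm_nonneg (m - c)]
  have hnm : n ≠ m := by
    rintro rfl
    linarith
  rw [latticeMatrix_of_ne hnm, latticeMatrix_of_ne (sub_ne_zero.1 (norm_pos_iff.1 hnc))]
  have hmc := latticePoint_sub m c ▸ norm_latticePoint_le (m - c)
  have hnc' := norm_sub_le_norm_latticePoint_sub n c
  exact hK.norm_sub_le hδ hnc (by linarith [norm_nonneg (m - c)]) hmc hnc'

theorem IsHolderKernel.exists_hormanderCondition (hδ : 0 < δ) (hK : IsHolderKernel K δ C) :
    ∃ D, HormanderCondition (latticeMatrix K) (2 * d + 1) D := by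
  obtain ⟨W, hW⟩ := exists_sum_norm_sub_rpow_le d hδ
  refine ⟨C * (d : ℝ≥0) ^ δ * W, fun c m N hN => ?_⟩
  push_cast at hN ⊢
  rcases eq_or_ne m c with rfl | hmc
  · simp only [sub_self, norm_zero, Finset.sum_const_zero]
    positivity
  have hR : 1 ≤ ‖m - c‖ := one_le_norm_of_ne_zero (sub_ne_zero.2 hmc)
  have hRδ : ‖m - c‖ ^ δ ≠ 0 := (Real.rpow_pos_of_pos (by linarith) δ).ne'
  calc ∑ n ∈ N, ‖latticeMatrix K n m - latticeMatrix K n c‖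
      ≤ ∑ n ∈ N, C * (d * ‖m - c‖) ^ δ * ‖n - c‖ ^ (-(d + δ)) :=
        Finset.sum_le_sum fun n hn => hK.norm_latticeMatrix_sub_le hδ.le (hN n hn)
    _ ≤ C * (d * ‖m - c‖) ^ δ * (W * ‖m - c‖ ^ (-δ)) := by
        rw [← Finset.mul_sum]
        gcongr
        refine hW c _ hR N fun n hn => ?_
        have : 0 ≤ d * ‖m - c‖ := by positivity
        linarith [hN n hn]
    _ = C * d ^ δ * W := by
        rw [Real.mul_rpow (by positivity) (by positivity), Real.rpow_neg (by positivity)]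
        field_simp

end LatticeMatrix

section InnerProductMatrix

variable {𝕜 ι κ V H H' : Type*} [RCLike 𝕜] [AddCommMonoid V] [Module 𝕜 V]
  [NormedAddCommGroup H] [InnerProductSpace 𝕜 H] [NormedAddCommGroup H'] [InnerProductSpace 𝕜 H']

theorem norm_sum_smul_sq_of_orthonormal {v : κ → H} (hv : Orthonormal 𝕜 v) (S : Finset κ)
    (f : κ → 𝕜) : ‖∑ m ∈ S, f m • v m‖ ^ 2 = ∑ m ∈ S, ‖f m‖ ^ 2 := by
  have h := hv.inner_sum f f S
  simp only [inner_self_eq_norm_sq_to_K, RCLike.conj_mul] at h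
  exact_mod_cast h

theorem hasStrongType_inner_map (J : V →ₗ[𝕜] H) (T : V →ₗ[𝕜] H') {C : ℝ≥0}
    (hT : ∀ f, ‖T f‖ ≤ C * ‖J f‖) {u : ι → H'} (hu : Orthonormal 𝕜 u) {v : κ → V}
    (hv : Orthonormal 𝕜 fun m => J (v m)) :
    HasStrongType (fun n m => inner 𝕜 (u n) (T (v m))) 2 C := by
  intro N S f
  simp only [Real.rpow_two]
  have section_eq : ∀ n, ∑ m ∈ S, inner 𝕜 (u n) (T (v m)) * f m =
      inner 𝕜 (u n) (T (∑ m ∈ S, f m • v m)) := fun n => by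
    simp only [map_sum, map_smul, inner_sum, inner_smul_right, mul_comm (f _)]
  calc ∑ n ∈ N, ‖∑ m ∈ S, inner 𝕜 (u n) (T (v m)) * f m‖ ^ 2
      ≤ ‖T (∑ m ∈ S, f m • v m)‖ ^ 2 := by
        simpa only [section_eq] using hu.sum_inner_products_le _
    _ ≤ (C * ‖J (∑ m ∈ S, f m • v m)‖) ^ 2 := by
        gcongr
        exact hT _
    _ = C ^ 2 * ∑ m ∈ S, ‖f m‖ ^ 2 := by
        simp only [mul_pow, map_sum, map_smul, norm_sum_smul_sq_of_orthonormal hv]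

end InnerProductMatrix

section Averages

theorem norm_integral_mul_sub_le {𝕜 α : Type*} [RCLike 𝕜] [MeasurableSpace α] {μ : Measure α}
    {F u : α → 𝕜} {c : 𝕜} {R : ℝ} (hu : Integrable u μ) (hFu : Integrable (fun x => F x * u x) μ)
    (hF : ∀ᵐ x ∂μ, u x ≠ 0 → ‖F x - c‖ ≤ R) :
    ‖∫ x, F x * u x ∂μ - c * ∫ x, u x ∂μ‖ ≤ R * ∫ x, ‖u x‖ ∂μ := by
  rw [← integral_const_mul, ← integral_sub hFu (hu.const_mul c), ← integral_const_mul]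
  refine norm_integral_le_of_norm_le (hu.norm.const_mul R) ?_
  filter_upwards [hF] with x hx
  rw [← sub_mul, norm_mul]
  rcases eq_or_ne (u x) 0 with h | h
  · simp [h]
  · exact mul_le_mul_of_nonneg_right (hx h) (norm_nonneg _)

end Averages

section LatticeBumps

variable {d : ℕ} {φ : 𝓢(EuclideanSpace ℝ (Fin d), ℂ)} {n m : Fin d → ℤ}

/-- The translate of `φ` by a lattice point. -/
noncomputable def latticeTranslate (φ : 𝓢(EuclideanSpace ℝ (Fin d), ℂ)) (n : Fin d → ℤ) :
    𝓢(EuclideanSpace ℝ (Fin d), ℂ) :=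
  SchwartzMap.compSubConstCLM ℂ (latticePoint n) φ

theorem norm_toLp_latticeTranslate (φ : 𝓢(EuclideanSpace ℝ (Fin d), ℂ)) (n : Fin d → ℤ) :
    ‖(latticeTranslate φ n).toLp 2 volume‖ = ‖φ.toLp 2 volume‖ := by
  rw [SchwartzMap.norm_toLp, SchwartzMap.norm_toLp]
  exact congrArg ENNReal.toReal (eLpNorm_comp_measurePreserving
    φ.continuous.aestronglyMeasurable (measurePreserving_sub_right volume (latticePoint n)))

theorem integral_latticeTranslate (φ : 𝓢(EuclideanSpace ℝ (Fin d), ℂ)) (n : Fin d → ℤ) :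
    ∫ x, latticeTranslate φ n x = ∫ x, φ x :=
  integral_sub_right_eq_self φ _

theorem integral_norm_latticeTranslate (φ : 𝓢(EuclideanSpace ℝ (Fin d), ℂ)) (n : Fin d → ℤ) :
    ∫ x, ‖latticeTranslate φ n x‖ = ∫ x, ‖φ x‖ :=
  integral_sub_right_eq_self (fun x => ‖φ x‖) _

/-- A test function of `L²` norm `1` and nonzero mean, supported so close to the origin that its
translates by distinct lattice points are orthogonal in `L²`. -/
structure IsLatticeBump (φ : 𝓢(EuclideanSpace ℝ (Fin d), ℂ)) : Prop where
  apply_eq_zero : ∀ x, 1 / 4 ≤ ‖x‖ → φ x = 0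
  norm_toLp : ‖φ.toLp 2 volume‖ = 1
  integral_ne_zero : ∫ x, φ x ≠ 0

theorem exists_isLatticeBump (d : ℕ) :
    ∃ φ : 𝓢(EuclideanSpace ℝ (Fin d), ℂ), IsLatticeBump φ := by
  let b : ContDiffBump (0 : EuclideanSpace ℝ (Fin d)) :=
    ⟨1 / 8, 1 / 4, by norm_num, by norm_num⟩
  let ψ : 𝓢(EuclideanSpace ℝ (Fin d), ℂ) :=
    HasCompactSupport.toSchwartzMap (f := fun x => (b x : ℂ))
      (b.hasCompactSupport.comp_left Complex.ofReal_zero)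
      (Complex.ofRealCLM.contDiff.comp b.contDiff)
  have hψ : ∫ x, ψ x ≠ 0 := by
    have : ∫ x, ψ x = ((∫ x, b x : ℝ) : ℂ) := integral_complex_ofReal
    exact this ▸ Complex.ofReal_ne_zero.2 b.integral_pos.ne'
  have hnorm : ‖ψ.toLp 2 volume‖ ≠ 0 := fun h => hψ <| by
    have : ψ = 0 := SchwartzMap.injective_toLp 2 volume <|
      (norm_eq_zero.1 h).trans (map_zero (SchwartzMap.toLpCLM ℂ ℂ 2 volume)).symm
    simp [this]
  have hnorm' : ((‖ψ.toLp 2 volume‖⁻¹ : ℝ) : ℂ) ≠ 0 := by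
    exact_mod_cast inv_ne_zero hnorm
  refine ⟨((‖ψ.toLp 2 volume‖⁻¹ : ℝ) : ℂ) • ψ, fun x hx => ?_, ?_, ?_⟩
  · have : ψ x = 0 := Complex.ofReal_eq_zero.2 (b.zero_of_le_dist ((dist_zero_right x).symm ▸ hx))
    simp [this]
  · have := map_smul (SchwartzMap.toLpCLM ℂ ℂ 2 volume) ((‖ψ.toLp 2 volume‖⁻¹ : ℝ) : ℂ) ψ
    simp only [SchwartzMap.toLpCLM_apply] at this
    rw [this, norm_smul, Complex.norm_real, norm_inv, norm_norm, inv_mul_cancel₀ hnorm]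
  · simp only [smul_apply, integral_smul]
    exact smul_ne_zero hnorm' hψ

namespace IsLatticeBump

variable (hφ : IsLatticeBump φ)

include hφ

theorem norm_sub_lt_of_ne_zero {x : EuclideanSpace ℝ (Fin d)} (hx : latticeTranslate φ n x ≠ 0) :
    ‖x - latticePoint n‖ < 1 / 4 :=
  not_le.1 fun h => hx (hφ.apply_eq_zero _ h)

theorem support_subset (n : Fin d → ℤ) :
    Function.support (latticeTranslate φ n) ⊆ Metric.closedBall (latticePoint n) (1 / 4) :=
  fun _ hx => mem_closedBall_iff_norm.2 (hφ.norm_sub_lt_of_ne_zero hx).le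

theorem orthonormal :
    Orthonormal ℂ fun n => (latticeTranslate φ n).toLp 2 volume := by
  refine ⟨fun n => (norm_toLp_latticeTranslate φ n).trans hφ.norm_toLp, fun n m hnm => ?_⟩
  beta_reduce
  rw [L2.inner_def]
  refine integral_eq_zero_of_ae ?_
  filter_upwards [(latticeTranslate φ n).coeFn_toLp 2 volume,
    (latticeTranslate φ m).coeFn_toLp 2 volume] with x hn hm
  rw [hn, hm, RCLike.inner_apply, Pi.zero_apply]
  by_contra! h
  have hxm := hφ.norm_sub_lt_of_ne_zero (left_ne_zero_of_mul h)
  have hxn := hφ.norm_sub_lt_of_ne_zero (star_ne_zero.1 (right_ne_zero_of_mul h))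
  linarith [half_norm_sub_le_norm_sub_latticePoint hnm hxn.le,
    one_le_norm_of_ne_zero (sub_ne_zero.2 hnm)]

end IsLatticeBump

end LatticeBumps

section OffDiagonalDecay

theorem exists_hasStrongType_of_norm_le_rpow {d : ℕ} {𝕜 : Type*} [RCLike 𝕜]
    {e : (Fin d → ℤ) → (Fin d → ℤ) → 𝕜} {δ p : ℝ} (hδ : 0 < δ) (hp : 1 ≤ p) {A D : ℝ≥0}
    (hdiag : ∀ n, ‖e n n‖ ≤ A) (hoff : ∀ n m, n ≠ m → ‖e n m‖ ≤ D * ‖n - m‖ ^ (-(d + δ))) :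
    ∃ B, HasStrongType e p B := by
  classical
  obtain ⟨W, hW⟩ := exists_sum_norm_sub_rpow_le d hδ
  have sum_le : ∀ (x : (Fin d → ℤ) → 𝕜) (c : Fin d → ℤ), ‖x c‖ ≤ A →
      (∀ m, m ≠ c → ‖x m‖ ≤ D * ‖m - c‖ ^ (-(d + δ))) →
      ∀ S : Finset (Fin d → ℤ), ∑ m ∈ S, ‖x m‖ ≤ (A + D * W : ℝ≥0) := by
    intro x c hc hx S
    calc ∑ m ∈ S, ‖x m‖ ≤ ∑ m ∈ insert c (S.erase c), ‖x m‖ :=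
          Finset.sum_le_sum_of_subset_of_nonneg (Finset.insert_erase_subset c S)
            fun _ _ _ => norm_nonneg _
      _ = ‖x c‖ + ∑ m ∈ S.erase c, ‖x m‖ := Finset.sum_insert (Finset.notMem_erase c S)
      _ ≤ A + ∑ m ∈ S.erase c, D * ‖m - c‖ ^ (-(d + δ)) := by
          gcongr with m hm
          exact hx m (Finset.ne_of_mem_erase hm)
      _ ≤ A + D * (W * 1 ^ (-δ)) := by
          rw [← Finset.mul_sum]
          gcongr
          exact hW c 1 le_rfl _ fun m hm =>
            one_le_norm_of_ne_zero (sub_ne_zero.2 (Finset.ne_of_mem_erase hm))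
      _ = (A + D * W : ℝ≥0) := by simp
  refine ⟨A + D * W, hasStrongType_of_sum_norm_le hp
    (fun S n => sum_le (e n) n (hdiag n) (fun m hm => ?_) S)
    fun N m => sum_le (flip e m) m (hdiag m) (fun n hn => hoff n m hn) N⟩
  exact norm_sub_rev n m ▸ hoff n m hm.symm

end OffDiagonalDecay

section Sampling

variable {d : ℕ} {K : EuclideanSpace ℝ (Fin d) → EuclideanSpace ℝ (Fin d) → ℂ} {δ : ℝ}
  {C C' A : ℝ≥0} {φ : 𝓢(EuclideanSpace ℝ (Fin d), ℂ)} {n m : Fin d → ℤ}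

/-- The operator `T` is given by integration against the kernel `K` away from the support of its
argument. The behaviour of `T` on the diagonal is not constrained: multiplication operators have
kernel `0` in this sense. -/
def HasKernelOffSupport (T : 𝓢(EuclideanSpace ℝ (Fin d), ℂ) → EuclideanSpace ℝ (Fin d) → ℂ)
    (K : EuclideanSpace ℝ (Fin d) → EuclideanSpace ℝ (Fin d) → ℂ) : Prop :=
  ∀ f : 𝓢(EuclideanSpace ℝ (Fin d), ℂ), HasCompactSupport f →
    ∀ᵐ x, x ∉ tsupport f → T f x = ∫ y, K x y * f y

theorem norm_sub_latticePoint_le (hK : IsHolderKernel K δ C) (hK' : IsHolderKernel (flip K) δ C')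
    (hδ : 0 ≤ δ) (hnm : n ≠ m) {x y : EuclideanSpace ℝ (Fin d)}
    (hx : ‖x - latticePoint n‖ ≤ 1 / 4) (hy : ‖y - latticePoint m‖ ≤ 1 / 4) :
    ‖K x y - K (latticePoint n) (latticePoint m)‖ ≤
      (C + C') * 2 ^ (d + δ) * ‖n - m‖ ^ (-(d + δ)) := by
  have one_le := one_le_norm_of_ne_zero (sub_ne_zero.2 hnm)
  have hxm := half_norm_sub_le_norm_sub_latticePoint hnm hx
  have hmn := half_norm_sub_le_norm_sub_latticePoint hnm.symm
    (x := latticePoint m) (by rw [sub_self, norm_zero]; norm_num)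
  rw [norm_sub_rev m n] at hmn
  have hyK := hK.norm_sub_le hδ (h := 1) (y' := y) (by positivity) (by linarith) (by linarith) hxm
  have hxK := hK'.norm_sub_le hδ (h := 1) (y' := x) (by positivity) (by linarith) (by linarith) hmn
  simp only [Real.one_rpow, mul_one, flip] at hyK hxK
  calc ‖K x y - K (latticePoint n) (latticePoint m)‖
      ≤ ‖K x y - K x (latticePoint m)‖
        + ‖K x (latticePoint m) - K (latticePoint n) (latticePoint m)‖ :=
        norm_sub_le_norm_sub_add_norm_sub _ _ _
    _ ≤ (C + C') * (‖n - m‖ / 2) ^ (-(d + δ)) := by linarith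
    _ = (C + C') * 2 ^ (d + δ) * ‖n - m‖ ^ (-(d + δ)) := by
        rw [Real.div_rpow (norm_nonneg _) zero_le_two, Real.rpow_neg zero_le_two, div_inv_eq_mul,
          mul_comm (‖n - m‖ ^ _), mul_assoc]

namespace IsLatticeBump

variable (hφ : IsLatticeBump φ) (hK : IsHolderKernel K δ C) (hδ : 0 < δ)

include hφ hK hδ

theorem integrable_mul {x : EuclideanSpace ℝ (Fin d)} (hx : 1 / 4 < ‖x - latticePoint m‖) :
    Integrable fun y => K x y * latticeTranslate φ m y := by
  rw [← integrableOn_iff_integrable_of_support_subset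
    ((Function.support_mul_subset_right _ _).trans (hφ.support_subset m))]
  refine ContinuousOn.integrableOn_compact (isCompact_closedBall _ _) ?_
  refine .mul (fun y hy => ?_) (latticeTranslate φ m).continuous.continuousOn
  refine (hK.continuousAt hδ ?_).continuousWithinAt
  rintro rfl
  rw [mem_closedBall_iff_norm] at hy
  linarith

variable (hK' : IsHolderKernel (flip K) δ C') (hnm : n ≠ m)

include hK' hnm

theorem norm_integral_sub_le {x : EuclideanSpace ℝ (Fin d)} (hx : ‖x - latticePoint n‖ ≤ 1 / 4) :
    ‖(∫ y, K x y * latticeTranslate φ m y)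
        - K (latticePoint n) (latticePoint m) * ∫ y, φ y‖ ≤
      (C + C') * 2 ^ (d + δ) * ‖n - m‖ ^ (-(d + δ)) * ∫ y, ‖φ y‖ := by
  have hxm := half_norm_sub_le_norm_sub_latticePoint hnm hx
  rw [← integral_latticeTranslate φ m, ← integral_norm_latticeTranslate φ m]
  refine norm_integral_mul_sub_le (latticeTranslate φ m).integrable
    (hφ.integrable_mul hK hδ ?_) (.of_forall fun y hy => ?_)
  · linarith [one_le_norm_of_ne_zero (sub_ne_zero.2 hnm)]
  · exact norm_sub_latticePoint_le hK hK' hδ.le hnm hx (hφ.norm_sub_lt_of_ne_zero hy).le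

variable {T : 𝓢(EuclideanSpace ℝ (Fin d), ℂ) →ₗ[ℂ]
    Lp ℂ 2 (volume : Measure (EuclideanSpace ℝ (Fin d)))}
  (hTK : HasKernelOffSupport (fun f => T f) K)

include hTK

theorem ae_norm_sub_le :
    ∀ᵐ x, latticeTranslate φ n x ≠ 0 →
      ‖T (latticeTranslate φ m) x - K (latticePoint n) (latticePoint m) * ∫ y, φ y‖ ≤
        (C + C') * 2 ^ (d + δ) * ‖n - m‖ ^ (-(d + δ)) * ∫ y, ‖φ y‖ := by
  have hsupp := hφ.support_subset m
  filter_upwards [hTK _ (.of_support_subset_isCompact (isCompact_closedBall _ _) hsupp)]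
    with x hTx hx
  have hxn := (hφ.norm_sub_lt_of_ne_zero hx).le
  have hxm := half_norm_sub_le_norm_sub_latticePoint hnm hxn
  rw [hTx fun h => ?_]
  · exact hφ.norm_integral_sub_le hK hδ hK' hnm hxn
  · have := mem_closedBall_iff_norm.1 (closure_minimal hsupp Metric.isClosed_closedBall h)
    linarith [one_le_norm_of_ne_zero (sub_ne_zero.2 hnm)]

theorem norm_inner_sub_le :
    ‖inner ℂ ((latticeTranslate φ n).toLp 2 volume) (T (latticeTranslate φ m))
        - K (latticePoint n) (latticePoint m) * ‖∫ x, φ x‖ ^ 2‖ ≤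
      (C + C') * 2 ^ (d + δ) * ‖n - m‖ ^ (-(d + δ)) * (∫ x, ‖φ x‖) ^ 2 := by
  have inner_eq : (fun x => inner ℂ ((latticeTranslate φ n).toLp 2 volume x)
      (T (latticeTranslate φ m) x)) =ᵐ[volume]
      fun x => T (latticeTranslate φ m) x * (starRingEnd ℂ) (latticeTranslate φ n x) := by
    filter_upwards [(latticeTranslate φ n).coeFn_toLp 2 volume] with x hx
    rw [hx, RCLike.inner_apply]
  have integral_conj_eq : ∫ x, (starRingEnd ℂ) (latticeTranslate φ n x) =
      (starRingEnd ℂ) (∫ x, φ x) := by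
    rw [integral_conj, integral_latticeTranslate]
  have := norm_integral_mul_sub_le (u := fun x => (starRingEnd ℂ) (latticeTranslate φ n x))
    ((LinearIsometryEquiv.integrable_comp_iff RCLike.conjLIE).2 (latticeTranslate φ n).integrable)
    ((L2.integrable_inner _ _).congr inner_eq)
    ((hφ.ae_norm_sub_le hK hδ hK' hnm hTK).mono fun x hx hne =>
      hx fun h => hne (by rw [h, map_zero]))
  simpa only [L2.inner_def, integral_congr_ae inner_eq, integral_conj_eq, mul_assoc, pow_two,
    Complex.mul_conj', RCLike.norm_conj, integral_norm_latticeTranslate] using this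

end IsLatticeBump

end Sampling

section LpRealization

theorem norm_le_mul_norm_of_eLpNorm_le {α F G : Type*} [MeasurableSpace α] {μ : Measure α}
    [NormedAddCommGroup F] [NormedAddCommGroup G] {p : ℝ≥0∞} {A : ℝ≥0} {f : Lp F p μ}
    {g : Lp G p μ} (h : eLpNorm f p μ ≤ A * eLpNorm g p μ) : ‖f‖ ≤ A * ‖g‖ := by
  simpa only [Lp.norm_def, ENNReal.toReal_mul, ENNReal.coe_toReal] using
    ENNReal.toReal_mono (ENNReal.mul_ne_top ENNReal.coe_ne_top (Lp.eLpNorm_ne_top g)) h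

theorem exists_linearMap_toLp {𝕜 α V F : Type*} [NormedRing 𝕜] [MeasurableSpace α] {μ : Measure α}
    [AddCommMonoid V] [Module 𝕜 V] [NormedAddCommGroup F] [Module 𝕜 F] [IsBoundedSMul 𝕜 F]
    {p : ℝ≥0∞} (T : V →ₗ[𝕜] (α → F)) (hT : ∀ f, MemLp (T f) p μ) :
    ∃ S : V →ₗ[𝕜] Lp F p μ, ∀ f, S f =ᵐ[μ] T f := by
  refine ⟨{ toFun := fun f => (hT f).toLp (T f), map_add' := fun f g => ?_,
            map_smul' := fun c f => ?_ }, fun f => (hT f).coeFn_toLp⟩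
  · simp only [map_add, MemLp.toLp_add (hT f) (hT g)]
  · simp only [map_smul, MemLp.toLp_const_smul c (hT f), RingHom.id_apply]

end LpRealization

section LatticeL2

variable {d : ℕ} {K : EuclideanSpace ℝ (Fin d) → EuclideanSpace ℝ (Fin d) → ℂ} {δ : ℝ}
  {C C' A : ℝ≥0}

theorem exists_hasStrongType_two_latticeMatrix {T : 𝓢(EuclideanSpace ℝ (Fin d), ℂ) →ₗ[ℂ]
      Lp ℂ 2 (volume : Measure (EuclideanSpace ℝ (Fin d)))}
    (hT : ∀ f, ‖T f‖ ≤ A * ‖f.toLp 2 volume‖) (hTK : HasKernelOffSupport (fun f => T f) K)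
    (hδ : 0 < δ) (hK : IsHolderKernel K δ C) (hK' : IsHolderKernel (flip K) δ C') :
    ∃ B, HasStrongType (latticeMatrix K) 2 B := by
  obtain ⟨φ, hφ⟩ := exists_isLatticeBump d
  set s : (Fin d → ℤ) → (Fin d → ℤ) → ℂ := fun n m =>
    inner ℂ ((latticeTranslate φ n).toLp 2 volume) (T (latticeTranslate φ m))
  have hs : HasStrongType s 2 A := hasStrongType_inner_map
    (SchwartzMap.toLpCLM ℂ ℂ 2 volume).toLinearMap T hT hφ.orthonormal hφ.orthonormal
  set a : ℂ := ((‖∫ x, φ x‖ : ℂ) ^ 2)⁻¹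
  have ha : a * (‖∫ x, φ x‖ : ℂ) ^ 2 = 1 := inv_mul_cancel₀ <|
    pow_ne_zero 2 (Complex.ofReal_ne_zero.2 (norm_ne_zero_iff.2 hφ.integral_ne_zero))
  set J : ℝ≥0 := ‖∫ x, ‖φ x‖‖₊
  have hJ : ∫ x, ‖φ x‖ = J := (Real.norm_of_nonneg (by positivity)).symm
  obtain ⟨B, hB⟩ : ∃ B, HasStrongType (fun n m => latticeMatrix K n m - a * s n m) 2 B := by
    refine exists_hasStrongType_of_norm_le_rpow hδ one_le_two (A := ‖a‖₊ * A)
      (D := ‖a‖₊ * ((C + C') * 2 ^ (d + δ) * J ^ 2)) (fun n => ?_) fun n m hnm => ?_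
    · rw [latticeMatrix_self, zero_sub, norm_neg]
      exact (hs.const_mul a).norm_apply_le two_pos n n
    · have inner_sub := hJ ▸ hφ.norm_inner_sub_le hK hδ hK' hnm hTK
      have factor : latticeMatrix K n m - a * s n m =
          -(a * (s n m - K (latticePoint n) (latticePoint m) * ‖∫ x, φ x‖ ^ 2)) := by
        rw [latticeMatrix_of_ne hnm]
        linear_combination -K (latticePoint n) (latticePoint m) * ha
      rw [factor, norm_neg, norm_mul]
      push_cast
      refine (mul_le_mul_of_nonneg_left inner_sub (norm_nonneg a)).trans_eq ?_
      ring
  exact ⟨_, by simpa only [sub_add_cancel] using hB.add (hs.const_mul a) one_le_two⟩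

end LatticeL2

section LpExtension

variable {𝕜 ι κ : Type*} [RCLike 𝕜] {k : ι → κ → 𝕜} {C : ℝ≥0} {p : ℝ≥0∞} [Fact (1 ≤ p)]

theorem HasStrongType.summable_mul (h : HasStrongType k p.toReal C) (hp : p ≠ ∞)
    (f : lp (fun _ : κ => 𝕜) p) (n : ι) : Summable fun m => k n m * f m := by
  have hp0 : 0 < p.toReal := ENNReal.toReal_pos (zero_lt_one.trans_le Fact.out).ne' hp
  choose c hc hcf using fun m => RCLike.exists_norm_eq_mul_self (k n m * f m)
  refine .of_norm (summable_of_sum_le (c := C * ‖f‖) (fun _ => norm_nonneg _) fun S => ?_)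
  have sum_norm_eq : ∑ m ∈ S, ‖k n m * f m‖ = ‖∑ m ∈ S, k n m * (c m * f m)‖ := by
    simp only [mul_left_comm (k n _), ← hcf]
    rw [← RCLike.ofReal_sum, RCLike.norm_ofReal, abs_of_nonneg (by positivity)]
  rw [sum_norm_eq, ← Real.rpow_le_rpow_iff (by positivity) (by positivity) hp0,
    Real.mul_rpow (by positivity) (by positivity)]
  have := h {n} S fun m => c m * f m
  simp only [Finset.sum_singleton, norm_mul, hc, one_mul] at this
  refine this.trans ?_
  gcongr
  exact lp.sum_rpow_le_norm_rpow hp0 f S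

theorem HasStrongType.sum_norm_tsum_rpow_le (h : HasStrongType k p.toReal C) (hp : p ≠ ∞)
    (f : lp (fun _ : κ => 𝕜) p) (N : Finset ι) :
    ∑ n ∈ N, ‖∑' m, k n m * f m‖ ^ p.toReal ≤ (C * ‖f‖) ^ p.toReal := by
  have hp0 : 0 < p.toReal := ENNReal.toReal_pos (zero_lt_one.trans_le Fact.out).ne' hp
  have ht : Tendsto (fun S : Finset κ => ∑ n ∈ N, ‖∑ m ∈ S, k n m * f m‖ ^ p.toReal) atTop
      (𝓝 (∑ n ∈ N, ‖∑' m, k n m * f m‖ ^ p.toReal)) :=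
    tendsto_finsetSum _ fun n _ =>
      ((h.summable_mul hp f n).hasSum.norm).rpow_const (Or.inr hp0.le)
  refine le_of_tendsto' ht fun S => (h N S f).trans ?_
  rw [Real.mul_rpow (by positivity) (by positivity)]
  gcongr
  exact lp.sum_rpow_le_norm_rpow hp0 f S

theorem HasStrongType.exists_continuousLinearMap (h : HasStrongType k p.toReal C) (hp : p ≠ ∞) :
    ∃ S : lp (fun _ : κ => 𝕜) p →L[𝕜] lp (fun _ : ι => 𝕜) p,
      ∀ f n, S f n = ∑' m, k n m * f m := by
  have hp0 : 0 < p.toReal := ENNReal.toReal_pos (zero_lt_one.trans_le Fact.out).ne' hp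
  let L : lp (fun _ : κ => 𝕜) p →ₗ[𝕜] lp (fun _ : ι => 𝕜) p :=
    { toFun f := ⟨fun n => ∑' m, k n m * f m, memℓp_gen' (h.sum_norm_tsum_rpow_le hp f)⟩
      map_add' f g := by
        ext n
        simpa only [lp.coeFn_add, Pi.add_apply, mul_add] using
          (h.summable_mul hp f n).tsum_add (h.summable_mul hp g n)
      map_smul' c f := by
        ext n
        simpa only [lp.coeFn_smul, Pi.smul_apply, smul_eq_mul, RingHom.id_apply,
          mul_left_comm _ c] using tsum_mul_left }
  exact ⟨L.mkContinuous C fun f =>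
    lp.norm_le_of_forall_sum_le hp0 (by positivity) (h.sum_norm_tsum_rpow_le hp f), fun _ _ => rfl⟩

end LpExtension

section DiscreteAnalogue

variable {d : ℕ} {K : EuclideanSpace ℝ (Fin d) → EuclideanSpace ℝ (Fin d) → ℂ}

theorem discreteTerm_eq (f : (Fin d → ℤ) → ℂ) (n : Fin d → ℤ) :
    discreteTerm K f n =
      (fun m => latticeMatrix K n m * f m) ∘ ((↑) : {m : Fin d → ℤ // m ≠ n} → Fin d → ℤ) := by
  ext m
  simp only [discreteTerm, Function.comp_apply, latticeMatrix_of_ne m.2.symm]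

theorem discreteAnalogue_eq (f : (Fin d → ℤ) → ℂ) (n : Fin d → ℤ) :
    discreteAnalogue K f n = ∑' m, latticeMatrix K n m * f m := by
  rw [discreteAnalogue, discreteTerm_eq]
  refine tsum_subtype_eq_of_support_subset (f := fun m => latticeMatrix K n m * f m)
    (s := {m | m ≠ n}) fun m hm hmn => hm ?_
  subst hmn
  simp only [latticeMatrix_self, zero_mul]

end DiscreteAnalogue

section DiscreteBound

variable {d : ℕ} {K : EuclideanSpace ℝ (Fin d) → EuclideanSpace ℝ (Fin d) → ℂ} {δ : ℝ}
  {A C C' : ℝ≥0}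

theorem exists_hasStrongType_latticeMatrix {T : 𝓢(EuclideanSpace ℝ (Fin d), ℂ) →ₗ[ℂ]
      Lp ℂ 2 (volume : Measure (EuclideanSpace ℝ (Fin d)))}
    (hT : ∀ f, ‖T f‖ ≤ A * ‖f.toLp 2 volume‖) (hTK : HasKernelOffSupport (fun f => T f) K)
    (hδ : 0 < δ) (hK : IsHolderKernel K δ C) (hK' : IsHolderKernel (flip K) δ C') {p : ℝ}
    (hp : 1 < p) : ∃ B, HasStrongType (latticeMatrix K) p B := by
  rcases eq_or_ne d 0 with rfl | hd
  · exact exists_hasStrongType_of_norm_le_rpow hδ hp.le (A := 0) (D := 0)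
      (fun n => by simp [latticeMatrix_self]) fun n m hnm => absurd (Subsingleton.elim n m) hnm
  · obtain ⟨B, hB⟩ := exists_hasStrongType_two_latticeMatrix hT hTK hδ hK hK'
    obtain ⟨D, hD⟩ := hK.exists_hormanderCondition hδ
    obtain ⟨D', hD'⟩ := hK'.exists_hormanderCondition hδ
    exact hD.exists_hasStrongType hd (latticeMatrix_flip (K := K) ▸ hD') hB hp

end DiscreteBound

section CalderonZygmundOperators

variable {d : ℕ} {T : 𝓢(EuclideanSpace ℝ (Fin d), ℂ) →ₗ[ℂ] (EuclideanSpace ℝ (Fin d) → ℂ)}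
  {K : EuclideanSpace ℝ (Fin d) → EuclideanSpace ℝ (Fin d) → ℂ}

theorem isHolderKernel_one_of_norm_fderiv_le {C : ℝ≥0}
    (hdiff : ∀ x y, x ≠ y → DifferentiableAt ℝ (K x) y)
    (hC : ∀ x y, x ≠ y → ‖fderiv ℝ (K x) y‖ ≤ C / ‖x - y‖ ^ (d + 1)) :
    IsHolderKernel K 1 (C * 2 ^ (d + 1)) := by
  intro x y y' hhalf
  rcases eq_or_ne x y with rfl | hxy
  · rw [sub_self, norm_zero] at hhalf
    have : y' = x := sub_eq_zero.1 (norm_le_zero_iff.1 (by linarith))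
    rw [this, sub_self, norm_zero]
    positivity
  have hpos : 0 < ‖x - y‖ := norm_pos_iff.2 (sub_ne_zero.2 hxy)
  have far : ∀ z ∈ Metric.closedBall y ‖y' - y‖, ‖x - y‖ / 2 ≤ ‖x - z‖ := fun z hz => by
    rw [mem_closedBall_iff_norm] at hz
    linarith [norm_sub_le_norm_sub_add_norm_sub x z y]
  have off_diag : ∀ z ∈ Metric.closedBall y ‖y' - y‖, x ≠ z := fun z hz =>
    sub_ne_zero.1 (norm_pos_iff.1 ((half_pos hpos).trans_le (far z hz)))
  have mean_value : ‖K x y' - K x y‖ ≤ C / (‖x - y‖ / 2) ^ (d + 1) * ‖y' - y‖ := by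
    refine (convex_closedBall y ‖y' - y‖).norm_image_sub_le_of_norm_fderiv_le (𝕜 := ℝ)
      (fun z hz => hdiff x z (off_diag z hz)) (fun z hz => (hC x z (off_diag z hz)).trans ?_)
      (Metric.mem_closedBall_self (norm_nonneg _)) (mem_closedBall_iff_norm.2 le_rfl)
    gcongr
    exact far z hz
  refine mean_value.trans_eq ?_
  rw [Real.rpow_neg hpos.le, ← Nat.cast_add_one, Real.rpow_natCast, Real.rpow_one, div_pow]
  push_cast
  field_simp

namespace IsCalderonZygmund

theorem hasKernelOffSupport (hT : IsCalderonZygmund T K) : HasKernelOffSupport T K := by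
  intro f _
  filter_upwards [hT.principal_value f] with x hx hxf
  obtain ⟨r, hr, hball⟩ := Metric.isOpen_iff.1 (isClosed_tsupport f).isOpen_compl x hxf
  refine tendsto_nhds_unique (hx.congr' ?_) tendsto_const_nhds
  filter_upwards [Ioo_mem_nhdsGT hr] with ε hε
  refine setIntegral_eq_integral_of_forall_compl_eq_zero fun y hy => ?_
  have hyr : y ∈ Metric.ball x r :=
    mem_ball_iff_norm'.2 ((not_lt.1 hy).trans_lt hε.2)
  rw [image_eq_zero_of_notMem_tsupport (hball hyr), mul_zero]

theorem differentiableAt (hT : IsCalderonZygmund T K) {x y : EuclideanSpace ℝ (Fin d)}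
    (hxy : x ≠ y) :
    DifferentiableAt ℝ (fun z : EuclideanSpace ℝ (Fin d) × EuclideanSpace ℝ (Fin d) => K z.1 z.2)
      (x, y) :=
  (hT.contDiffOn.differentiableOn one_ne_zero).differentiableAt
    ((isOpen_ne_fun continuous_fst continuous_snd).mem_nhds hxy)

theorem exists_isHolderKernel_one (hT : IsCalderonZygmund T K) :
    ∃ C, IsHolderKernel K 1 C ∧ IsHolderKernel (flip K) 1 C := by
  obtain ⟨C, hC⟩ := hT.smoothness
  refine ⟨C.toNNReal * 2 ^ (d + 1),
    isHolderKernel_one_of_norm_fderiv_le (fun x y hxy => ?_) fun x y hxy => ?_,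
    isHolderKernel_one_of_norm_fderiv_le (fun y x hyx => ?_) fun y x hyx => ?_⟩
  · exact (hT.differentiableAt hxy).comp y (f := fun y' => (x, y')) (by fun_prop)
  · refine (le_add_of_nonneg_left (norm_nonneg _)).trans ((hC x y hxy).trans ?_)
    gcongr
    exact C.le_coe_toNNReal
  · exact (hT.differentiableAt hyx.symm).comp x (f := fun x' => (x', y)) (by fun_prop)
  · refine (le_add_of_nonneg_right (norm_nonneg _)).trans ((hC x y hyx.symm).trans ?_)
    rw [norm_sub_rev]
    gcongr
    exact C.le_coe_toNNReal

end IsCalderonZygmund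

end CalderonZygmundOperators

theorem theoremA1_general {d : ℕ}
    (T : 𝓢(EuclideanSpace ℝ (Fin d), ℂ) →ₗ[ℂ] (EuclideanSpace ℝ (Fin d) → ℂ))
    (K : EuclideanSpace ℝ (Fin d) → EuclideanSpace ℝ (Fin d) → ℂ)
    (hT : ∃ A : ℝ≥0, ∀ f : 𝓢(EuclideanSpace ℝ (Fin d), ℂ),
      MemLp (T f) 2 volume ∧ eLpNorm (T f) 2 volume ≤ A * eLpNorm f 2 volume)
    (hTK : HasKernelOffSupport T K) {δ : ℝ} (hδ : 0 < δ)
    {C : ℝ≥0} (hK : IsHolderKernel K δ C) (hK' : IsHolderKernel (flip K) δ C)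
    (p : ℝ≥0∞) [Fact (1 ≤ p)] (hp : 1 < p) (hp' : p < ∞) :
    (∀ (f : lp (fun _ : Fin d → ℤ => ℂ) p) (n : Fin d → ℤ), Summable (discreteTerm K f n)) ∧
    ∃ S : lp (fun _ : Fin d → ℤ => ℂ) p →L[ℂ] lp (fun _ : Fin d → ℤ => ℂ) p,
      ∀ (f : lp (fun _ : Fin d → ℤ => ℂ) p) (n : Fin d → ℤ),
        S f n = discreteAnalogue K f n := by
  obtain ⟨A, hA⟩ := hT
  obtain ⟨T₂, hT₂⟩ := exists_linearMap_toLp T fun f => (hA f).1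
  have bounded : ∀ f, ‖T₂ f‖ ≤ A * ‖f.toLp 2 volume‖ := fun f => norm_le_mul_norm_of_eLpNorm_le <|
    by simpa only [eLpNorm_congr_ae (hT₂ f), eLpNorm_congr_ae (f.coeFn_toLp 2 volume)]
      using (hA f).2
  have kernel : HasKernelOffSupport (fun f => T₂ f) K := fun f hf => by
    filter_upwards [hT₂ f, hTK f hf] with x hx hxf
    rwa [hx]
  have one_lt : 1 < p.toReal := ENNReal.toReal_one ▸ ENNReal.toReal_strict_mono hp'.ne hp
  obtain ⟨B, hB⟩ := exists_hasStrongType_latticeMatrix bounded kernel hδ hK hK' one_lt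
  obtain ⟨S, hS⟩ := hB.exists_continuousLinearMap hp'.ne
  refine ⟨fun f n => ?_, S, fun f n => (hS f n).trans (discreteAnalogue_eq _ _).symm⟩
  rw [discreteTerm_eq]
  exact (hB.summable_mul hp'.ne f n).comp_injective Subtype.val_injective

theorem theoremA1 {d : ℕ}
    (T : 𝓢(EuclideanSpace ℝ (Fin d), ℂ) →ₗ[ℂ] (EuclideanSpace ℝ (Fin d) → ℂ))
    (K : EuclideanSpace ℝ (Fin d) → EuclideanSpace ℝ (Fin d) → ℂ)
    (hT : IsCalderonZygmund T K)
    (p : ℝ≥0∞) [Fact (1 ≤ p)] (hp : 1 < p) (hp' : p < ∞) :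
    (∀ (f : lp (fun _ : Fin d → ℤ => ℂ) p) (n : Fin d → ℤ), Summable (discreteTerm K f n)) ∧
    ∃ S : lp (fun _ : Fin d → ℤ => ℂ) p →L[ℂ] lp (fun _ : Fin d → ℤ => ℂ) p,
      ∀ (f : lp (fun _ : Fin d → ℤ => ℂ) p) (n : Fin d → ℤ),
        S f n = discreteAnalogue K f n := by
  obtain ⟨C, hK, hK'⟩ := hT.exists_isHolderKernel_one
  exact theoremA1_general T K hT.bounded_L2 hT.hasKernelOffSupport one_pos hK hK' p hp hp'
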